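/- Let $Z,\lambda_1,\lambda_2\in\mathbb R$ and consider in $H^1(\mathbb R)=H^1(\mathbb R;\mathbb C)$ the Cauchy problem $$ iu_t-A_Zu+(\lambda_1|u|^2+\lambda_2|u|^4)u=0,\qquad u(0)=u_0\in H^1(\mathbb R), \tag{1}$$ where $A_Z=-\frac{d^2}{dx^2}-Z\delta(x):H^1(\mathbb R)\to H^{-1}(\mathbb R)$ is given by $\langle A_Zu,v\rangle=\int_{\mathbb R}u'\,\overline{v'}\,dx-Z\,u(0)\overline{v(0)}$ for $u,v\in H^1(\mathbb R)$. A solution on a time interval $J$ is a function $u\in C(J;H^1(\mathbb R))\cap C^1(J;H^{-1}(\mathbb R))$ that satisfies the equation in $H^{-1}(\mathbb R)$ for every $t\in J$. For an open set $D\subseteq H^1(\mathbb R)$, we say that (1) is globally well-posed for data in $D$ if - for every $u_0\in D$ there is a solution $u$ on $J=\mathbb R$ with $u(0)=u_0$; - this solution is unique: for every $T>0$, every solution on $[-T,T]$ with the same initial value $u_0$ coincides with $u$ on $[-T,T]$; - for every $T>0$ the map $u_0\mapsto u$ from $D$ to $C([-T,T];H^1(\mathbb R))$ is smooth ($C^\infty$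 over the reals), in particular continuous. **Theorem.** (i) For every $\lambda_2>0$ there is $\delta>0$, depending only on $\lambda_2$, such that for all $Z,\lambda_1\in\mathbb R$ the Cauchy problem (1) is globally well-posed for data in $\{u_0\in H^1(\mathbb R):\|u_0\|_{L^2(\mathbb R)}<\delta\}$. (ii) For every $\lambda_2<0$ and all $Z,\lambda_1\in\mathbb R$, the Cauchy problem (1) is globally well-posed for data in $H^1(\mathbb R)$, with no restriction on the size of $u_0$. -/

import Mathlib

open MeasureTheory Set
open scoped ContDiff ComplexConjugate

noncomputable section

namespace DeltaNLS

/-- Du Bois-Reymond lemma on the line: a locally integrable function whose weak derivative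
vanishes is a.e. constant. -/
theorem ae_const_of_weak_deriv_zero {h : ℝ → ℝ} (hh : LocallyIntegrable h volume)
    (h0 : ∀ φ : ℝ → ℝ, ContDiff ℝ ∞ φ → HasCompactSupport φ → ∫ x, deriv φ x * h x = 0) :
    ∃ c : ℝ, ∀ᵐ x, h x = c := by
  -- a normalized bump function
  let b : ContDiffBump (0 : ℝ) := ⟨1, 2, one_pos, one_lt_two⟩
  set ψ : ℝ → ℝ := b.normed volume with hψ
  have hψs : ContDiff ℝ ∞ ψ := b.contDiff_normed
  have hψc : HasCompactSupport ψ := b.hasCompactSupport_normed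
  have hψ1 : ∫ x, ψ x = 1 := b.integral_normed
  have hint : ∀ φ : ℝ → ℝ, ContDiff ℝ ∞ φ → HasCompactSupport φ →
      Integrable (fun x => φ x * h x) := fun φ hφ hc => by
    simpa [smul_eq_mul] using hh.integrable_smul_left_of_hasCompactSupport hφ.continuous hc
  set c : ℝ := ∫ x, ψ x * h x with hcdef
  refine ⟨c, ?_⟩
  have key : ∀ᵐ x, (fun x => h x - c) x = 0 := by
    refine ae_eq_zero_of_integral_contDiff_smul_eq_zero
      (hh.sub (locallyIntegrable_const c)) ?_
    intro φ hφ hφc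
    set m : ℝ := ∫ x, φ x with hm
    have hφi : Integrable φ := hφ.continuous.integrable_of_hasCompactSupport hφc
    have hψi : Integrable ψ := hψs.continuous.integrable_of_hasCompactSupport hψc
    -- the primitive of a compactly supported function of mean zero
    set χ : ℝ → ℝ := fun x => φ x - m * ψ x with hχ
    have hχs : ContDiff ℝ ∞ χ := hφ.sub (contDiff_const.mul hψs)
    have hχcs : HasCompactSupport χ := hφc.sub hψc.mul_left
    have hχi : Integrable χ := hφi.sub (hψi.const_mul m)
    have hχ0 : ∫ x, χ x = 0 := by
      rw [hχ, integral_sub hφi (hψi.const_mul m), integral_const_mul, hψ1]; simp [hm]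
    obtain ⟨R, hR0, hR⟩ : ∃ R : ℝ, 0 < R ∧ ∀ x, R < |x| → χ x = 0 := by
      obtain ⟨R, hR0, hR⟩ := hχcs.isBounded.subset_closedBall_lt 0 0
      refine ⟨R, hR0, fun x hx => ?_⟩
      by_contra hne
      have : x ∈ Metric.closedBall (0 : ℝ) R := hR (subset_tsupport _ hne)
      simp at this
      linarith
    set P : ℝ → ℝ := fun x => ∫ t in (-(R + 1))..x, χ t with hP
    have hPd : ∀ x, HasDerivAt P (χ x) x := fun x =>
      intervalIntegral.integral_hasDerivAt_right
        (hχs.continuous.intervalIntegrable _ _)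
        (hχs.continuous.stronglyMeasurableAtFilter _ _) hχs.continuous.continuousAt
    have hPderiv : deriv P = χ := funext fun x => (hPd x).deriv
    have hPs : ContDiff ℝ ∞ P := by
      rw [contDiff_infty_iff_deriv]
      exact ⟨fun x => (hPd x).differentiableAt, hPderiv ▸ hχs⟩
    have hPc : HasCompactSupport P := by
      refine HasCompactSupport.of_support_subset_isCompact
        (isCompact_Icc (a := -(R + 1)) (b := R + 1)) ?_
      intro x hx
      by_contra hxn
      apply hx
      rw [mem_Icc, not_and_or, not_le, not_le] at hxn
      rcases hxn with hxn | hxn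
      · rw [hP]
        refine intervalIntegral.integral_zero_ae (Filter.Eventually.of_forall fun t ht => ?_)
        rw [uIoc_of_ge hxn.le] at ht
        exact hR t (by rw [abs_of_neg (by linarith [ht.2])]; linarith [ht.2])
      · have hsupp : Function.support χ ⊆ Ioc (-(R + 1)) x := by
          intro t ht
          by_contra htn
          apply ht
          rw [mem_Ioc, not_and_or, not_lt, not_le] at htn
          apply hR
          rcases htn with htn | htn
          · rw [abs_of_neg (by linarith)]; linarith
          · rw [abs_of_pos (by linarith)]; linarith
        rw [hP]
        simp only
        rw [intervalIntegral.integral_eq_integral_of_support_subset hsupp, hχ0]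
    have h1 := h0 P hPs hPc
    rw [hPderiv] at h1
    have h2 : ∫ x, χ x * h x = (∫ x, φ x * h x) - m * c := by
      rw [hcdef, ← integral_const_mul, ← integral_sub (hint φ hφ hφc)
        ((hint ψ hψs hψc).const_mul m)]
      congr 1; ext x; simp only [hχ]; ring
    have h3 : ∫ x, φ x • (h x - c) = (∫ x, φ x * h x) - m * c := by
      rw [hm, ← integral_mul_const, ← integral_sub (hint φ hφ hφc) (hφi.mul_const c)]
      congr 1; ext x; simp only [smul_eq_mul]; ring
    rw [h3, ← h2, h1]
  filter_upwards [key] with x hx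
  simpa [sub_eq_zero] using hx

/-- If `g` is the weak derivative of `f`, then `f` agrees a.e. with a constant plus the
primitive of `g` (real-valued functions). -/
theorem ae_eq_primitive_of_weak_deriv {f g : ℝ → ℝ} (hf : LocallyIntegrable f volume)
    (hg : LocallyIntegrable g volume)
    (h : ∀ φ : ℝ → ℝ, ContDiff ℝ ∞ φ → HasCompactSupport φ →
      ∫ x, deriv φ x * f x = -∫ x, φ x * g x) :
    ∃ c : ℝ, ∀ᵐ x, f x = c + ∫ t in (0 : ℝ)..x, g t := by
  have hgi : ∀ a b : ℝ, IntervalIntegrable g volume a b := fun a b =>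
    intervalIntegrable_iff.mpr
      ((hg.integrableOn_isCompact isCompact_uIcc).mono_set uIoc_subset_uIcc)
  set G : ℝ → ℝ := fun x => ∫ t in (0 : ℝ)..x, g t with hG
  have hGc : Continuous G := intervalIntegral.continuous_primitive hgi 0
  have hGd : ∀ᵐ x, deriv G x = g x := by
    filter_upwards [LocallyIntegrable.ae_hasDerivAt_integral hg] with x hx
    exact (hx 0).deriv
  obtain ⟨c, hc⟩ := ae_const_of_weak_deriv_zero (h := fun x => f x - G x)
    (hf.sub hGc.locallyIntegrable) (by
      intro φ hφ hφc
      have hφ'c : Continuous (deriv φ) := hφ.continuous_deriv (by simp)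
      have hφ'cs : HasCompactSupport (deriv φ) := hφc.deriv
      have hi1 : Integrable (fun x => deriv φ x * f x) := by
        simpa [smul_eq_mul] using hf.integrable_smul_left_of_hasCompactSupport hφ'c hφ'cs
      have hi2 : Integrable (fun x => deriv φ x * G x) := by
        simpa [smul_eq_mul] using
          hGc.locallyIntegrable.integrable_smul_left_of_hasCompactSupport hφ'c hφ'cs
      obtain ⟨R, hR0, hR⟩ : ∃ R : ℝ, 0 < R ∧ tsupport φ ⊆ Metric.ball 0 R := by
        obtain ⟨R, hR0, hR⟩ := hφc.isBounded.subset_ball_lt 0 0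
        exact ⟨R, hR0, hR⟩
      have hsub : Metric.ball (0 : ℝ) R ⊆ Ioc (-R) R := by
        rw [Real.ball_eq_Ioo]; simp only [zero_sub, zero_add]; exact Ioo_subset_Ioc_self
      have hφz : ∀ x, x ∉ Metric.ball (0 : ℝ) R → φ x = 0 := fun x hx =>
        image_eq_zero_of_notMem_tsupport fun hx' => hx (hR hx')
      have hibp := AbsolutelyContinuousOnInterval.integral_mul_deriv_eq_deriv_mul
        (f := φ) (g := G) (a := -R) (b := R)
        ((hφ.of_le (by simp)).contDiffOn.absolutelyContinuousOnInterval)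
        ((hgi (-R) R).absolutelyContinuousOnInterval_intervalIntegral (by
          rw [uIcc_of_le (by linarith)]; constructor <;> linarith))
      rw [hφz R (by simp [abs_of_pos hR0]), hφz (-R) (by simp [abs_of_pos hR0])] at hibp
      have e1 : ∫ x in (-R)..R, deriv φ x * G x = ∫ x, deriv φ x * G x := by
        refine intervalIntegral.integral_eq_integral_of_support_subset fun x hx => ?_
        refine hsub (hR ?_)
        exact support_deriv_subset (fun h0 : deriv φ x = 0 => hx (by simp [h0]))
      have e2 : ∫ x in (-R)..R, φ x * deriv G x = ∫ x, φ x * deriv G x := by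
        refine intervalIntegral.integral_eq_integral_of_support_subset fun x hx => ?_
        refine hsub (hR (subset_tsupport _ ?_))
        exact fun h0 : φ x = 0 => hx (by simp [h0])
      have e3 : ∫ x, φ x * deriv G x = ∫ x, φ x * g x := by
        refine integral_congr_ae ?_
        filter_upwards [hGd] with x hx
        rw [hx]
      have e4 : ∫ x, deriv φ x * (f x - G x)
          = (∫ x, deriv φ x * f x) - ∫ x, deriv φ x * G x := by
        rw [← integral_sub hi1 hi2]
        congr 1; ext x; ring
      rw [e4, h φ hφ hφc, ← e1, ← e3, ← e2, hibp]
      ring)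
  refine ⟨c, ?_⟩
  filter_upwards [hc] with x hx
  linarith

/-- The space `L²(ℝ; ℂ)`. -/
abbrev L2 : Type := Lp ℂ 2 (volume : Measure ℝ)

/-- The space of pairs `(u, u')` in `L² × L²` such that
`u'` is the weak derivative of `u`, i.e. `∫ φ' u = -∫ φ u'` for every test function `φ`. -/
def weakDerivGraph : Submodule ℂ (WithLp 2 (L2 × L2)) where
  carrier := {p | ∀ φ : ℝ → ℝ, ContDiff ℝ ∞ φ → HasCompactSupport φ →
    ∫ x, deriv φ x • p.fst x = -∫ x, φ x • p.snd x}
  zero_mem' := by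
    intro φ _ _
    simp
  add_mem' := by
    intro p q hp hq φ hφ hφc
    have hφ'c : Continuous (deriv φ) := hφ.continuous_deriv (by simp)
    have hi : ∀ (η : ℝ → ℝ), Continuous η → HasCompactSupport η → ∀ f : L2,
        Integrable (fun x => η x • f x) := fun η hη hηc f =>
      ((Lp.memLp f).locallyIntegrable (by norm_num)).integrable_smul_left_of_hasCompactSupport
        hη hηc
    have ha : ∀ (η : ℝ → ℝ), Continuous η → HasCompactSupport η → ∀ f g : L2,
        ∫ x, η x • (f + g) x = (∫ x, η x • f x) + ∫ x, η x • g x := fun η hη hηc f g => by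
      rw [← integral_add (hi η hη hηc f) (hi η hη hηc g)]
      refine integral_congr_ae ?_
      filter_upwards [Lp.coeFn_add f g] with x hx
      rw [hx, Pi.add_apply, smul_add]
    rw [WithLp.add_fst, WithLp.add_snd, ha _ hφ'c hφc.deriv, ha _ hφ.continuous hφc,
      hp φ hφ hφc, hq φ hφ hφc]
    ring
  smul_mem' := by
    intro c p hp φ hφ hφc
    have hs : ∀ (η : ℝ → ℝ) (f : L2), ∫ x, η x • (c • f) x = c • ∫ x, η x • f x := fun η f => by
      rw [← integral_smul]
      refine integral_congr_ae ?_
      filter_upwards [Lp.coeFn_smul c f] with x hx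
      rw [hx, Pi.smul_apply, smul_comm]
    rw [WithLp.smul_fst, WithLp.smul_snd, hs, hs, hp φ hφ hφc, smul_neg]

/-- The Sobolev space `H¹(ℝ; ℂ)`: an element is a function `u ∈ L²` having a weak derivative
`u' ∈ L²`, stored together with `u'` (which is determined by `u`). It carries the inner product
and norm `(‖u‖²_{L²} + ‖u'‖²_{L²})^{1/2}` of the Hilbert sum `L² ⊕ L²`. -/
def H1 : Type := weakDerivGraph

namespace H1

instance instNormedAddCommGroup : NormedAddCommGroup H1 :=
  inferInstanceAs (NormedAddCommGroup weakDerivGraph)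

instance instInnerProductSpace : InnerProductSpace ℂ H1 :=
  inferInstanceAs (InnerProductSpace ℂ weakDerivGraph)

/-- The inclusion `H¹(ℝ) → L²(ℝ)`, `u ↦ u`. -/
def toL2 : H1 →L[ℂ] L2 := (WithLp.fstL 2 ℂ L2 L2).comp weakDerivGraph.subtypeL

/-- The weak derivative `H¹(ℝ) → L²(ℝ)`, `u ↦ u'`. -/
def derivL2 : H1 →L[ℂ] L2 := (WithLp.sndL 2 ℂ L2 L2).comp weakDerivGraph.subtypeL

/-- Every element of `H¹(ℝ)` has a continuous representative. -/
theorem exists_continuous_rep (u : H1) :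
    ∃ f : ℝ → ℂ, Continuous f ∧ ∀ᵐ x, toL2 u x = f x := by
  have hl : ∀ f : L2, LocallyIntegrable (fun x => f x) volume := fun f =>
    (Lp.memLp f).locallyIntegrable (by norm_num)
  have hre : ∀ f : L2, LocallyIntegrable (fun x => (f x).re) volume := fun f x => by
    obtain ⟨s, hs, h⟩ := hl f x
    exact ⟨s, hs, h.re⟩
  have him : ∀ f : L2, LocallyIntegrable (fun x => (f x).im) volume := fun f x => by
    obtain ⟨s, hs, h⟩ := hl f x
    exact ⟨s, hs, h.im⟩
  have hi : ∀ (η : ℝ → ℝ), Continuous η → HasCompactSupport η → ∀ f : L2,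
      Integrable (fun x => η x • f x) := fun η hη hηc f =>
    (hl f).integrable_smul_left_of_hasCompactSupport hη hηc
  have hw : ∀ φ : ℝ → ℝ, ContDiff ℝ ∞ φ → HasCompactSupport φ →
      ∫ x, deriv φ x • toL2 u x = -∫ x, φ x • derivL2 u x := u.2
  have hcont : ∀ g : ℝ → ℝ, LocallyIntegrable g volume →
      Continuous fun x => ∫ t in (0 : ℝ)..x, g t := fun g hg =>
    intervalIntegral.continuous_primitive (fun a b => intervalIntegrable_iff.mpr
      ((hg.integrableOn_isCompact isCompact_uIcc).mono_set uIoc_subset_uIcc)) 0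
  have hRe : ∀ (η : ℝ → ℝ), Continuous η → HasCompactSupport η → ∀ f : L2,
      ∫ x, η x * (f x).re = (∫ x, η x • f x).re := fun η hη hηc f => by
    have := integral_re (𝕜 := ℂ) (hi η hη hηc f)
    simpa using this
  have hIm : ∀ (η : ℝ → ℝ), Continuous η → HasCompactSupport η → ∀ f : L2,
      ∫ x, η x * (f x).im = (∫ x, η x • f x).im := fun η hη hηc f => by
    have := integral_im (𝕜 := ℂ) (hi η hη hηc f)
    simpa using this
  obtain ⟨a, ha⟩ := ae_eq_primitive_of_weak_deriv (hre (toL2 u)) (hre (derivL2 u)) (by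
    intro φ hφ hφc
    rw [hRe _ (hφ.continuous_deriv (by simp)) hφc.deriv, hRe _ hφ.continuous hφc,
      hw φ hφ hφc, Complex.neg_re])
  obtain ⟨b, hb⟩ := ae_eq_primitive_of_weak_deriv (him (toL2 u)) (him (derivL2 u)) (by
    intro φ hφ hφc
    rw [hIm _ (hφ.continuous_deriv (by simp)) hφc.deriv, hIm _ hφ.continuous hφc,
      hw φ hφ hφc, Complex.neg_im])
  refine ⟨fun x => ((a + ∫ t in (0 : ℝ)..x, (derivL2 u t).re : ℝ) : ℂ)
    + ((b + ∫ t in (0 : ℝ)..x, (derivL2 u t).im : ℝ) : ℂ) * Complex.I, ?_, ?_⟩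
  · have h1 := hcont _ (hre (derivL2 u))
    have h2 := hcont _ (him (derivL2 u))
    fun_prop
  · filter_upwards [ha, hb] with x hx hy
    rw [← hx, ← hy, Complex.re_add_im]

/-- The continuous representative of `u ∈ H¹(ℝ)`; it gives the point values of `u`. -/
def rep (u : H1) : ℝ → ℂ := (exists_continuous_rep u).choose

theorem continuous_rep (u : H1) : Continuous (rep u) := (exists_continuous_rep u).choose_spec.1

theorem toL2_ae_eq_rep (u : H1) : ∀ᵐ x, toL2 u x = rep u x :=
  (exists_continuous_rep u).choose_spec.2

end H1

/-- The space `H⁻¹(ℝ)`, the (conjugate-linear) dual of `H¹(ℝ)`, with the dual norm. -/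
abbrev Hneg1 : Type := H1 →L⋆[ℂ] ℂ

/-- The embedding `H¹(ℝ) ⊂ L²(ℝ) ⊂ H⁻¹(ℝ)`: `u` acts on `v ∈ H¹(ℝ)` as `∫ u v̄ dx`. -/
def H1.toHneg1 (u : H1) : Hneg1 := (innerSLFlip ℂ (H1.toL2 u)).comp H1.toL2

/-- The operator `A_Z = -d²/dx² - Z δ(x)` from `H¹(ℝ)` to `H⁻¹(ℝ)`:
`⟨A_Z u, v⟩ = ∫ u' v̄' dx - Z u(0) v̄(0)`. -/
def formA (Z : ℝ) (u v : H1) : ℂ :=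
  inner ℂ (H1.derivL2 v) (H1.derivL2 u) - Z * H1.rep u 0 * conj (H1.rep v 0)

/-- The cubic-quintic nonlinearity `(λ₁ |z|² + λ₂ |z|⁴) z`. -/
def nonlin (lam₁ lam₂ : ℝ) (z : ℂ) : ℂ := ((lam₁ * ‖z‖ ^ 2 + lam₂ * ‖z‖ ^ 4 : ℝ) : ℂ) * z

/-- `u` is a solution, on the time interval `J`, of
`i u_t - A_Z u + (λ₁ |u|² + λ₂ |u|⁴) u = 0` in the class `C(J; H¹(ℝ)) ∩ C¹(J; H⁻¹(ℝ))`;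
the equation is an identity in `H⁻¹(ℝ)` for every `t ∈ J` and `u'` is the time derivative of `u`
in the norm of `H⁻¹(ℝ)`. -/
def IsSolution (Z lam₁ lam₂ : ℝ) (J : Set ℝ) (u : ℝ → H1) : Prop :=
  ContinuousOn u J ∧
  ∃ u' : ℝ → Hneg1, ContinuousOn u' J ∧
    ∀ t ∈ J, HasDerivWithinAt (fun s => H1.toHneg1 (u s)) (u' t) J t ∧
      ∀ v : H1, Complex.I * u' t v - formA Z (u t) v
        + ∫ x, nonlin lam₁ lam₂ (H1.rep (u t) x) * conj (H1.rep v x) = 0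

/-- Global well-posedness in `H¹(ℝ)` of the Cauchy problem for initial data in `D ⊆ H¹(ℝ)`:
there is a data-to-solution map `S` such that, for every `u₀ ∈ D`, `S u₀` is a solution on all of
`ℝ` with value `u₀` at time `0`, and every solution with this initial value on an interval
`[-T, T]` coincides there with `S u₀`; moreover, for every `T > 0`, the map
`u₀ ↦ S u₀` from `D` to `C([-T, T]; H¹(ℝ))` (with the sup norm) is smooth (as a map between real
Banach spaces), in particular continuous. -/
def GloballyWellPosed (Z lam₁ lam₂ : ℝ) (D : Set H1) : Prop :=
  ∃ S : H1 → C(ℝ, H1),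
    (∀ u₀ ∈ D, IsSolution Z lam₁ lam₂ univ (S u₀) ∧ S u₀ 0 = u₀ ∧
      ∀ T > 0, ∀ w : ℝ → H1, IsSolution Z lam₁ lam₂ (Icc (-T) T) w → w 0 = u₀ →
        EqOn w (S u₀) (Icc (-T) T)) ∧
    ∀ T > 0, ContDiffOn ℝ ∞ (fun u₀ => (S u₀).restrict (Icc (-T) T)) D

end DeltaNLS

end

/-!
The form of `A_Z + m` is bounded and, for a large shift `m`, coercive on `H¹(ℝ)`, because point
evaluation is bounded there. Functional calculus therefore gives the group `e^{-it(A_Z + m)}`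
directly on the form domain `H¹(ℝ)` (`exists_form_group`), and no domain of a self-adjoint
operator on `L²(ℝ)`, with its jump condition at the origin, ever enters. Since `H¹(ℝ)` is an
algebra (`H1.mul`), the cubic-quintic nonlinearity is a polynomial map of `H¹(ℝ)` into itself, and
the equation becomes a Duhamel equation with a smooth nonlinearity.

For such equations (`exists_smooth_flow`) the map `u ↦ u - ∫₀ᵗ U(t - s) F(u(s)) ds` is smooth on
`C([-T, T]; H¹(ℝ))` and its derivative, the identity minus a Volterra operator, is invertible.
By the inverse function theorem solutions on `[-T, T]` persist, and depend smoothly on the data,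
near a given one. With an a priori bound, the parameters `s ∈ [0, 1]` for which the data `s u₀`
admit a solution on `[-T, T]` form an open and closed set containing `0`, so `s = 1` is one of them.

The bound (`exists_bound_of_isMild`) comes from conservation of mass and energy and from
`‖u‖_∞² ≤ 2 ‖u‖ ‖u'‖` (norms in `L²`): the point interaction and the cubic term are at most linear
in `‖u'‖`, and the quintic term either has a good sign or is at most `(2/3) λ₂ ‖u‖⁴ ‖u'‖²`, which
the kinetic energy absorbs when `‖u‖` is small. Energy conservation holds at `H¹` regularity: the
quadratic form is invariant under the group, so along a solution only the forcing contributes to it,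
and that cancels against the potential energy, whose gradient takes values in `H¹(ℝ)`
(`hasDerivWithinAt_of_gradient`).

Uniqueness in the full class of solutions (`IsSolution.eqOn`) is Grönwall's inequality for the
squared `L²` distance of two solutions.
-/

noncomputable section

namespace DeltaNLS

open Filter Topology

/-! ### Primitives of locally integrable complex functions -/

theorem locallyIntegrable_intervalIntegrable {g : ℝ → ℂ} (hg : LocallyIntegrable g volume)
    (a b : ℝ) : IntervalIntegrable g volume a b :=
  intervalIntegrable_iff.mpr
    ((hg.integrableOn_isCompact isCompact_uIcc).mono_set uIoc_subset_uIcc)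

theorem absolutelyContinuousOnInterval_primitive {g : ℝ → ℂ} (hg : LocallyIntegrable g volume)
    (a b : ℝ) : AbsolutelyContinuousOnInterval (fun x => ∫ t in a..x, g t) a b := by
  have hi := locallyIntegrable_intervalIntegrable hg
  have hre : ∀ x y, IntervalIntegrable (fun t => (g t).re) volume x y := fun x y =>
    ⟨(hi x y).1.re, (hi x y).2.re⟩
  have him : ∀ x y, IntervalIntegrable (fun t => (g t).im) volume x y := fun x y =>
    ⟨(hi x y).1.im, (hi x y).2.im⟩
  have h1 := (hre a b).absolutelyContinuousOnInterval_intervalIntegral (c := a) (by simp)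
  have h2 := (him a b).absolutelyContinuousOnInterval_intervalIntegral (c := a) (by simp)
  have hc : ∀ w : ℂ, AbsolutelyContinuousOnInterval (fun _ : ℝ => w) a b := fun w =>
    (contDiff_const (𝕜 := ℝ) (n := 1)).contDiffOn.absolutelyContinuousOnInterval
  have h3 := (h1.smul (hc 1)).add (h2.smul (hc Complex.I))
  suffices h : (fun x => ∫ t in a..x, g t) = ((fun x => ∫ t in a..x, (g t).re) • fun _ => (1 : ℂ))
      + ((fun x => ∫ t in a..x, (g t).im) • fun _ => Complex.I) by
    rw [h]; exact h3
  funext x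
  have hre' : IntervalIntegrable (fun t => ((g t).re : ℂ)) volume a x :=
    ⟨(hre a x).1.ofReal, (hre a x).2.ofReal⟩
  have him' : IntervalIntegrable (fun t => ((g t).im : ℂ)) volume a x :=
    ⟨(him a x).1.ofReal, (him a x).2.ofReal⟩
  simp only [Pi.add_apply, Pi.smul_apply', Complex.real_smul, mul_one]
  rw [← intervalIntegral.integral_ofReal, ← intervalIntegral.integral_ofReal,
    ← intervalIntegral.integral_mul_const, ← intervalIntegral.integral_add hre'
    (him'.mul_const _)]
  simp only [Complex.re_add_im]

/-- Leibniz rule for functions that are primitives of locally integrable functions. -/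
theorem mul_sub_mul_eq_integral {f f' g g' : ℝ → ℂ} (hf' : LocallyIntegrable f' volume)
    (hg' : LocallyIntegrable g' volume) (hf : ∀ x y, f y - f x = ∫ t in x..y, f' t)
    (hg : ∀ x y, g y - g x = ∫ t in x..y, g' t) (hfc : Continuous f) (hgc : Continuous g)
    (a b : ℝ) : f b * g b - f a * g a = ∫ t in a..b, (f' t * g t + f t * g' t) := by
  have hloc : LocallyIntegrable (fun t => f' t * g t + f t * g' t) volume := by
    rw [locallyIntegrable_iff] at hf' hg' ⊢
    exact fun k hk => ((hf' k hk).mul_continuousOn hgc.continuousOn hk).add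
      ((hg' k hk).continuousOn_mul hfc.continuousOn hk)
  have hAC : ∀ {h h' : ℝ → ℂ}, LocallyIntegrable h' volume →
      (∀ x y, h y - h x = ∫ t in x..y, h' t) → AbsolutelyContinuousOnInterval h a b := by
    intro h h' hl hh
    have h1 := absolutelyContinuousOnInterval_primitive hl a b
    have h2 : AbsolutelyContinuousOnInterval (fun _ : ℝ => h a) a b :=
      (contDiff_const (𝕜 := ℝ) (n := 1)).contDiffOn.absolutelyContinuousOnInterval
    suffices e : h = (fun _ => h a) + fun x => ∫ t in a..x, h' t by
      rw [e]; exact h2.add h1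
    funext x
    simp [← hh a x]
  have hder : ∀ {h h' : ℝ → ℂ}, LocallyIntegrable h' volume →
      (∀ x y, h y - h x = ∫ t in x..y, h' t) → ∀ᵐ x, HasDerivAt h (h' x) x := by
    intro h h' hl hh
    filter_upwards [LocallyIntegrable.ae_hasDerivAt_integral hl] with x hx
    have : h = fun x => h a + ∫ t in a..x, h' t := by ext y; simp [← hh a y]
    rw [this]
    exact (hx a).const_add _
  have hprim : ∀ x y, (∫ t in a..y, (f' t * g t + f t * g' t))
      - (∫ t in a..x, (f' t * g t + f t * g' t)) = ∫ t in x..y, (f' t * g t + f t * g' t) :=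
    fun x y => intervalIntegral.integral_interval_sub_left
      (locallyIntegrable_intervalIntegrable hloc _ _)
      (locallyIntegrable_intervalIntegrable hloc _ _)
  have hac : AbsolutelyContinuousOnInterval
      (fun x => f x * g x - ∫ t in a..x, (f' t * g t + f t * g' t)) a b :=
    ((hAC hf' hf).smul (hAC hg' hg)).sub (hAC hloc hprim)
  obtain ⟨C, hC⟩ := hac.const_of_ae_hasDerivAt_zero (by
    filter_upwards [hder hf' hf, hder hg' hg, hder hloc hprim] with x h1 h2 h3 _
    simpa using (h1.fun_mul h2).fun_sub h3)
  have h1 := hC a (by simp)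
  have h2 := hC b (by simp)
  simp only [intervalIntegral.integral_same, sub_zero] at h1 h2
  rw [h1, ← h2]
  ring

/-- If `g` is the weak derivative of `f`, then `f` agrees a.e. with a constant plus the
primitive of `g` (complex-valued functions). -/
theorem ae_eq_primitive_of_weak_deriv_complex {f g : ℝ → ℂ} (hf : LocallyIntegrable f volume)
    (hg : LocallyIntegrable g volume)
    (h : ∀ φ : ℝ → ℝ, ContDiff ℝ ∞ φ → HasCompactSupport φ →
      ∫ x, deriv φ x • f x = -∫ x, φ x • g x) :
    ∃ c : ℂ, ∀ᵐ x, f x = c + ∫ t in (0 : ℝ)..x, g t := by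
  have hre : ∀ {f : ℝ → ℂ}, LocallyIntegrable f volume →
      LocallyIntegrable (fun x => (f x).re) volume := fun hf x => by
    obtain ⟨s, hs, h⟩ := hf x
    exact ⟨s, hs, h.re⟩
  have him : ∀ {f : ℝ → ℂ}, LocallyIntegrable f volume →
      LocallyIntegrable (fun x => (f x).im) volume := fun hf x => by
    obtain ⟨s, hs, h⟩ := hf x
    exact ⟨s, hs, h.im⟩
  have hi : ∀ {η : ℝ → ℝ} {f : ℝ → ℂ}, Continuous η → HasCompactSupport η →
      LocallyIntegrable f volume → Integrable (fun x => η x • f x) := fun hη hηc hf =>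
    hf.integrable_smul_left_of_hasCompactSupport hη hηc
  have hRe : ∀ {η : ℝ → ℝ} {f : ℝ → ℂ}, Continuous η → HasCompactSupport η →
      LocallyIntegrable f volume → ∫ x, η x * (f x).re = (∫ x, η x • f x).re :=
    fun hη hηc hf => by
      have := integral_re (𝕜 := ℂ) (hi hη hηc hf)
      simpa using this
  have hIm : ∀ {η : ℝ → ℝ} {f : ℝ → ℂ}, Continuous η → HasCompactSupport η →
      LocallyIntegrable f volume → ∫ x, η x * (f x).im = (∫ x, η x • f x).im :=
    fun hη hηc hf => by
      have := integral_im (𝕜 := ℂ) (hi hη hηc hf)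
      simpa using this
  obtain ⟨a, ha⟩ := ae_eq_primitive_of_weak_deriv (hre hf) (hre hg) fun φ hφ hφc => by
    rw [hRe (hφ.continuous_deriv (by simp)) hφc.deriv hf, hRe hφ.continuous hφc hg,
      h φ hφ hφc, Complex.neg_re]
  obtain ⟨b, hb⟩ := ae_eq_primitive_of_weak_deriv (him hf) (him hg) fun φ hφ hφc => by
    rw [hIm (hφ.continuous_deriv (by simp)) hφc.deriv hf, hIm hφ.continuous hφc hg,
      h φ hφ hφc, Complex.neg_im]
  refine ⟨⟨a, b⟩, ?_⟩
  filter_upwards [ha, hb] with x hx hy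
  have hgi := locallyIntegrable_intervalIntegrable hg 0 x
  have e1 : ∫ t in (0 : ℝ)..x, (g t).re = (∫ t in (0 : ℝ)..x, g t).re := by
    simpa using Complex.reCLM.intervalIntegral_comp_comm hgi
  have e2 : ∫ t in (0 : ℝ)..x, (g t).im = (∫ t in (0 : ℝ)..x, g t).im := by
    simpa using Complex.imCLM.intervalIntegral_comp_comm hgi
  apply Complex.ext
  · rw [hx, e1]; simp
  · rw [hy, e2]; simp

theorem locallyIntegrable_L2 (f : L2) : LocallyIntegrable f volume :=
  (Lp.memLp f).locallyIntegrable (by norm_num)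

namespace H1

/-! ### The Hilbert space `H¹(ℝ)` and its pointwise calculus -/

theorem weak_deriv (u : H1) {φ : ℝ → ℝ} (hφ : ContDiff ℝ ∞ φ) (hφc : HasCompactSupport φ) :
    ∫ x, deriv φ x • toL2 u x = -∫ x, φ x • derivL2 u x := u.2 φ hφ hφc

theorem norm_sq_eq (u : H1) : ‖u‖ ^ 2 = ‖toL2 u‖ ^ 2 + ‖derivL2 u‖ ^ 2 :=
  WithLp.prod_norm_sq_eq_of_L2 u.1

theorem norm_toL2_le (u : H1) : ‖toL2 u‖ ≤ ‖u‖ := by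
  nlinarith [norm_sq_eq u, norm_nonneg u, norm_nonneg (toL2 u), sq_nonneg ‖derivL2 u‖]

theorem norm_derivL2_le (u : H1) : ‖derivL2 u‖ ≤ ‖u‖ := by
  nlinarith [norm_sq_eq u, norm_nonneg u, norm_nonneg (derivL2 u), sq_nonneg ‖toL2 u‖]

theorem norm_le_add (u : H1) : ‖u‖ ≤ ‖toL2 u‖ + ‖derivL2 u‖ := by
  nlinarith [norm_sq_eq u, norm_nonneg u, norm_nonneg (toL2 u), norm_nonneg (derivL2 u)]

instance instCompleteSpace : CompleteSpace H1 := by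
  have : IsClosed (weakDerivGraph : Set (WithLp 2 (L2 × L2))) := by
    have heq : (weakDerivGraph : Set (WithLp 2 (L2 × L2))) =
        ⋂ (φ : ℝ → ℝ) (_ : ContDiff ℝ ∞ φ) (_ : HasCompactSupport φ),
          {p | ∫ x, deriv φ x • p.fst x = -∫ x, φ x • p.snd x} := by
      ext p
      simp only [mem_iInter]
      rfl
    rw [heq]
    refine isClosed_iInter fun φ => isClosed_iInter fun hφ => isClosed_iInter fun hφc => ?_
    have hcont : ∀ η : ℝ → ℝ, Continuous η → HasCompactSupport η →
        Continuous fun f : L2 => ∫ x, η x • f x := fun η hη hηc => by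
      have hm : MemLp (fun x => (η x : ℂ)) 2 volume :=
        (Complex.continuous_ofReal.comp hη).memLp_of_hasCompactSupport
          (hηc.comp_left Complex.ofReal_zero)
      have : (fun f : L2 => ∫ x, η x • f x) = fun f => inner ℂ (hm.toLp _) f := by
        ext f
        rw [L2.inner_def]
        refine integral_congr_ae ?_
        filter_upwards [hm.coeFn_toLp] with x hx
        rw [hx]
        simp [mul_comm]
      rw [this]
      fun_prop
    exact isClosed_eq
      ((hcont _ (hφ.continuous_deriv (by simp)) hφc.deriv).comp (WithLp.fstL 2 ℂ L2 L2).continuous)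
      ((hcont _ hφ.continuous hφc).comp (WithLp.sndL 2 ℂ L2 L2).continuous).neg
  exact this.completeSpace_coe

/-- Point values of `u ∈ H¹(ℝ)` satisfy the fundamental theorem of calculus. -/
theorem rep_sub_rep (u : H1) (x y : ℝ) : rep u y - rep u x = ∫ t in x..y, derivL2 u t := by
  have hl := locallyIntegrable_L2
  obtain ⟨c, hc⟩ := ae_eq_primitive_of_weak_deriv_complex (hl (toL2 u)) (hl (derivL2 u))
    fun φ hφ hφc => weak_deriv u hφ hφc
  have hi := locallyIntegrable_intervalIntegrable (hl (derivL2 u))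
  have h : rep u = fun x => c + ∫ t in (0 : ℝ)..x, derivL2 u t := by
    refine Continuous.ae_eq_iff_eq volume (continuous_rep u)
      (continuous_const.fun_add (intervalIntegral.continuous_primitive hi 0)) |>.1 ?_
    filter_upwards [hc, toL2_ae_eq_rep u] with x h1 h2
    rw [← h2, h1]
  rw [h]
  simp only [add_sub_add_left_eq_sub]
  exact intervalIntegral.integral_interval_sub_left (hi _ _) (hi _ _)

theorem rep_eq_of_ae {u : H1} {f : ℝ → ℂ} (hf : Continuous f) (h : ∀ᵐ x, toL2 u x = f x) :
    rep u = f := by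
  refine (Continuous.ae_eq_iff_eq volume (continuous_rep u) hf).1 ?_
  filter_upwards [h, toL2_ae_eq_rep u] with x h1 h2
  rw [← h2, h1]

theorem rep_add (u v : H1) (x : ℝ) : rep (u + v) x = rep u x + rep v x := by
  refine congrFun (rep_eq_of_ae ((continuous_rep u).fun_add (continuous_rep v)) ?_) x
  filter_upwards [Lp.coeFn_add (toL2 u) (toL2 v), toL2_ae_eq_rep u, toL2_ae_eq_rep v]
    with x h1 h2 h3
  rw [map_add, h1, Pi.add_apply, h2, h3]

theorem rep_smul (c : ℂ) (u : H1) (x : ℝ) : rep (c • u) x = c * rep u x := by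
  refine congrFun (rep_eq_of_ae (continuous_const.fun_mul (continuous_rep u)) ?_) x
  filter_upwards [Lp.coeFn_smul c (toL2 u), toL2_ae_eq_rep u] with x h1 h2
  rw [map_smul, h1, Pi.smul_apply, h2, smul_eq_mul]

theorem rep_sub (u v : H1) (x : ℝ) : rep (u - v) x = rep u x - rep v x := by
  have := rep_add u ((-1 : ℂ) • v) x
  rw [rep_smul, neg_one_smul, ← sub_eq_add_neg] at this
  rw [this]; ring

theorem rep_real_smul (c : ℝ) (u : H1) (x : ℝ) : rep (c • u) x = c * rep u x := by
  have := rep_smul (c : ℂ) u x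
  rwa [Complex.coe_smul] at this

/-- An element of `H¹(ℝ)` is determined by its values as an `L²` function. -/
theorem toL2_injective : Function.Injective toL2 := by
  rw [injective_iff_map_eq_zero]
  intro u hu
  have h0 : ∀ᵐ x, toL2 u x = 0 := by
    rw [hu]; exact Lp.coeFn_zero ℂ 2 volume
  have hd : derivL2 u = 0 := by
    rw [Lp.eq_zero_iff_ae_eq_zero]
    refine ae_eq_zero_of_integral_contDiff_smul_eq_zero (locallyIntegrable_L2 _) fun φ hφ hφc => ?_
    rw [← neg_eq_zero, ← weak_deriv u hφ hφc]
    refine integral_eq_zero_of_ae ?_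
    filter_upwards [h0] with x hx
    simp [hx]
  have := norm_sq_eq u
  rw [hu, hd] at this
  simpa using this

theorem ext_rep {u v : H1} (h : ∀ x, rep u x = rep v x) : u = v := by
  apply toL2_injective
  apply Lp.ext
  filter_upwards [toL2_ae_eq_rep u, toL2_ae_eq_rep v] with x h1 h2
  rw [h1, h2, h]

/-- The element of `H¹(ℝ)` given by a function `f ∈ L²` that is a primitive of `g ∈ L²`. -/
def ofPrimitive (f g : ℝ → ℂ) (hf : MemLp f 2 volume) (hg : MemLp g 2 volume)
    (h : ∀ x y, f y - f x = ∫ t in x..y, g t) : H1 :=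
  ⟨WithLp.toLp 2 (hf.toLp f, hg.toLp g), by
    intro φ hφ hφc
    have hgl : LocallyIntegrable g volume := hg.locallyIntegrable (by norm_num)
    have hgi := locallyIntegrable_intervalIntegrable hgl
    have hfc : Continuous f := by
      have : f = fun x => f 0 + ∫ t in (0 : ℝ)..x, g t := by ext x; simp [← h 0 x]
      rw [this]
      exact continuous_const.add (intervalIntegral.continuous_primitive hgi 0)
    have e1 : ∫ x, deriv φ x • (hf.toLp f) x = ∫ x, ((deriv φ x : ℝ) : ℂ) * f x := by
      refine integral_congr_ae ?_
      filter_upwards [hf.coeFn_toLp] with x hx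
      rw [hx, Complex.real_smul]
    have e2 : ∫ x, φ x • (hg.toLp g) x = ∫ x, (φ x : ℂ) * g x := by
      refine integral_congr_ae ?_
      filter_upwards [hg.coeFn_toLp] with x hx
      rw [hx, Complex.real_smul]
    change ∫ x, deriv φ x • (hf.toLp f) x = -∫ x, φ x • (hg.toLp g) x
    rw [e1, e2, eq_neg_iff_add_eq_zero]
    have hφ'c : Continuous (deriv φ) := hφ.continuous_deriv (by simp)
    have i1 : Integrable fun x => ((deriv φ x : ℝ) : ℂ) * f x := by
      simpa using hfc.locallyIntegrable.integrable_smul_left_of_hasCompactSupport hφ'c hφc.deriv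
    have i2 : Integrable fun x => (φ x : ℂ) * g x := by
      simpa using hgl.integrable_smul_left_of_hasCompactSupport hφ.continuous hφc
    rw [← integral_add i1 i2]
    obtain ⟨R, hR0, hR⟩ := hφc.isBounded.subset_ball_lt 0 0
    have hsub : Metric.ball (0 : ℝ) R ⊆ Ioc (-R) R := by
      rw [Real.ball_eq_Ioo]; simp only [zero_sub, zero_add]; exact Ioo_subset_Ioc_self
    have hφz : ∀ x, x ∉ Metric.ball (0 : ℝ) R → φ x = 0 := fun x hx =>
      image_eq_zero_of_notMem_tsupport fun hx' => hx (hR hx')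
    have hFTC : ∀ x y, (φ y : ℂ) - φ x = ∫ t in x..y, ((deriv φ t : ℝ) : ℂ) := fun x y => by
      rw [intervalIntegral.integral_ofReal, intervalIntegral.integral_deriv_eq_sub (f := φ)
        (fun t _ => (hφ.differentiable (by simp)).differentiableAt)
        (hφ'c.intervalIntegrable _ _)]
      simp
    have := mul_sub_mul_eq_integral (Complex.continuous_ofReal.comp hφ'c).locallyIntegrable hgl
      hFTC h (Complex.continuous_ofReal.comp hφ.continuous) hfc (-R) R
    rw [hφz R (by simp [abs_of_pos hR0]), hφz (-R) (by simp [abs_of_pos hR0])] at this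
    rw [← intervalIntegral.integral_eq_integral_of_support_subset (a := -R) (b := R)]
    · simpa using this.symm
    · intro x hx
      apply hsub
      by_contra hxn
      apply hx
      have hd : deriv φ x = 0 := by
        by_contra hne
        exact hxn (hR (support_deriv_subset hne))
      simp [hφz x hxn, hd]⟩

variable {f g : ℝ → ℂ} {hf : MemLp f 2 volume} {hg : MemLp g 2 volume}
    {h : ∀ x y, f y - f x = ∫ t in x..y, g t}

theorem toL2_ofPrimitive : toL2 (ofPrimitive f g hf hg h) = hf.toLp f := rfl

theorem derivL2_ofPrimitive : derivL2 (ofPrimitive f g hf hg h) = hg.toLp g := rfl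

theorem rep_ofPrimitive (hfc : Continuous f) : rep (ofPrimitive f g hf hg h) = f :=
  rep_eq_of_ae hfc (by rw [toL2_ofPrimitive]; exact hf.coeFn_toLp)

theorem memLp_rep (u : H1) : MemLp (rep u) 2 volume :=
  (memLp_congr_ae (toL2_ae_eq_rep u)).1 (Lp.memLp _)

/-- Pairings of `L²` functions in terms of point values. -/
theorem inner_toL2 (u v : H1) :
    inner ℂ (toL2 u) (toL2 v) = ∫ x, rep v x * conj (rep u x) := by
  rw [L2.inner_def]
  refine integral_congr_ae ?_
  filter_upwards [toL2_ae_eq_rep u, toL2_ae_eq_rep v] with x h1 h2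
  rw [h1, h2]
  simp

theorem integrable_rep_mul_conj (u v : H1) : Integrable fun x => rep v x * conj (rep u x) := by
  refine (L2.integrable_inner (𝕜 := ℂ) (toL2 u) (toL2 v)).congr ?_
  filter_upwards [toL2_ae_eq_rep u, toL2_ae_eq_rep v] with x h1 h2
  rw [h1, h2]
  simp

theorem conj_rep_sub (u : H1) (x y : ℝ) :
    conj (rep u y) - conj (rep u x) = ∫ t in x..y, conj (derivL2 u t) := by
  rw [← map_sub, rep_sub_rep]
  exact (Complex.conjCLE.toContinuousLinearMap.intervalIntegral_comp_comm
    (locallyIntegrable_intervalIntegrable (locallyIntegrable_L2 _) x y)).symm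

theorem locallyIntegrable_conj_L2 (f : L2) : LocallyIntegrable (fun x => conj (f x)) volume :=
  fun x => by
    obtain ⟨s, hs, h⟩ := locallyIntegrable_L2 f x
    exact ⟨s, hs, (Complex.conjCLE.toContinuousLinearMap.integrable_comp h)⟩

/-- The Gagliardo-Nirenberg inequality `‖u‖²_∞ ≤ 2 ‖u‖ ‖u'‖`. -/
theorem norm_rep_sq_le (u : H1) (x : ℝ) : ‖rep u x‖ ^ 2 ≤ 2 * ‖toL2 u‖ * ‖derivL2 u‖ := by
  have hl := locallyIntegrable_L2 (derivL2 u)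
  set h : ℝ → ℂ := fun t => derivL2 u t * conj (rep u t) + rep u t * conj (derivL2 u t) with hh
  have hint : Integrable (fun t => ‖toL2 u t‖ * ‖derivL2 u t‖) :=
    (Lp.memLp (toL2 u)).norm.integrable_mul (Lp.memLp (derivL2 u)).norm
  have hCS : ∫ t, ‖toL2 u t‖ * ‖derivL2 u t‖ ≤ ‖toL2 u‖ * ‖derivL2 u‖ := by
    have := integral_mul_norm_le_Lp_mul_Lq (μ := volume) (p := 2) (q := 2)
      Real.HolderConjugate.two_two (f := toL2 u) (g := derivL2 u)
      (by simpa using Lp.memLp (toL2 u)) (by simpa using Lp.memLp (derivL2 u))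
    have e : ∀ f : L2, (∫ t, ‖f t‖ ^ (2 : ℝ)) ^ (1 / (2 : ℝ)) = ‖f‖ := fun f => by
      rw [← Real.sqrt_eq_rpow, eq_comm, ← Real.sqrt_sq (norm_nonneg f)]
      congr 1
      rw [← inner_self_eq_norm_sq (𝕜 := ℂ), L2.inner_def, ← integral_re (L2.integrable_inner f f)]
      refine integral_congr_ae (Eventually.of_forall fun t => ?_)
      simp only [inner_self_eq_norm_sq, Real.rpow_two]
    rwa [e, e] at this
  have hb : ∀ a, ‖rep u x‖ ^ 2 - 2 * ‖toL2 u‖ * ‖derivL2 u‖ ≤ ‖rep u a‖ ^ 2 := fun a => by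
    have hF := mul_sub_mul_eq_integral hl (locallyIntegrable_conj_L2 _) (rep_sub_rep u)
      (conj_rep_sub u) (continuous_rep u) (Complex.continuous_conj.comp (continuous_rep u)) a x
    rw [Complex.mul_conj', Complex.mul_conj'] at hF
    have hle : ‖∫ t in a..x, h t‖ ≤ ∫ t, 2 * (‖toL2 u t‖ * ‖derivL2 u t‖) := by
      refine (intervalIntegral.norm_integral_le_integral_norm_uIoc).trans ?_
      refine (integral_mono_of_nonneg (Eventually.of_forall fun _ => norm_nonneg _)
        (hint.const_mul 2).integrableOn ?_).trans
        (setIntegral_le_integral (hint.const_mul 2) (Eventually.of_forall fun _ => by positivity))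
      refine ae_restrict_of_ae ?_
      filter_upwards [toL2_ae_eq_rep u] with t ht
      rw [ht]
      refine (norm_add_le _ _).trans (le_of_eq ?_)
      simp only [norm_mul, RCLike.norm_conj]
      ring
    rw [integral_const_mul] at hle
    have : ‖rep u x‖ ^ 2 - ‖rep u a‖ ^ 2 ≤ ‖∫ t in a..x, h t‖ := by
      rw [← hF]
      have := Complex.re_le_norm ((‖rep u x‖ : ℂ) ^ 2 - (‖rep u a‖ : ℂ) ^ 2)
      refine le_trans (le_of_eq ?_) this
      norm_cast
    linarith
  -- a function bounded below by a positive constant is not integrable on the line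
  by_contra! hlt
  have hi : Integrable fun a => ‖rep u a‖ ^ 2 := (memLp_two_iff_integrable_sq_norm
    (continuous_rep u).aestronglyMeasurable).1 (memLp_rep u)
  have hconst : Integrable (fun _ : ℝ => ‖rep u x‖ ^ 2 - 2 * ‖toL2 u‖ * ‖derivL2 u‖) := by
    refine hi.mono' aestronglyMeasurable_const (Eventually.of_forall fun a => ?_)
    rw [Real.norm_eq_abs, abs_of_pos (by linarith)]
    exact hb a
  rw [integrable_const_iff] at hconst
  rcases hconst with h0 | h0
  · linarith
  · exact (measure_lt_top (μ := (volume : Measure ℝ)) univ).ne Real.volume_univ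

/-- The Sobolev embedding `H¹(ℝ) ⊂ L^∞(ℝ)`. -/
theorem norm_rep_le (u : H1) (x : ℝ) : ‖rep u x‖ ≤ ‖u‖ := by
  have h1 := norm_rep_sq_le u x
  have h2 := norm_sq_eq u
  have : ‖rep u x‖ ^ 2 ≤ ‖u‖ ^ 2 := by nlinarith [sq_nonneg (‖toL2 u‖ - ‖derivL2 u‖)]
  exact (pow_le_pow_iff_left₀ (norm_nonneg _) (norm_nonneg _) two_ne_zero).1 this

/-- Evaluation at a point as a continuous linear functional on `H¹(ℝ)`. -/
def eval (x : ℝ) : H1 →L[ℂ] ℂ :=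
  LinearMap.mkContinuous
    { toFun := fun u => rep u x
      map_add' := fun u v => rep_add u v x
      map_smul' := fun c u => rep_smul c u x } 1 fun u => by
    rw [one_mul]; exact norm_rep_le u x

/-! ### `H¹(ℝ)` as an algebra -/

theorem memLp_continuous_mul {a : ℝ → ℂ} {C : ℝ} (ha : Continuous a) (hC : ∀ x, ‖a x‖ ≤ C)
    {b : ℝ → ℂ} (hb : MemLp b 2 volume) : MemLp (fun x => a x * b x) 2 volume :=
  MemLp.of_le_mul (c := C) hb (ha.aestronglyMeasurable.mul hb.1)
    (Eventually.of_forall fun x => by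
      rw [norm_mul]; exact mul_le_mul_of_nonneg_right (hC x) (norm_nonneg _))

/-- The product of two elements of `H¹(ℝ)`, with weak derivative `u'v + uv'`. -/
def mulFun (u v : H1) : H1 :=
  ofPrimitive (fun x => rep u x * rep v x)
    (fun x => derivL2 u x * rep v x + rep u x * derivL2 v x)
    (memLp_continuous_mul (continuous_rep u) (norm_rep_le u) (memLp_rep v))
    (((memLp_continuous_mul (continuous_rep v) (norm_rep_le v) (Lp.memLp (derivL2 u))).ae_eq
      (Eventually.of_forall fun _ => mul_comm _ _)).add
      (memLp_continuous_mul (continuous_rep u) (norm_rep_le u) (Lp.memLp (derivL2 v))))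
    (fun x y => mul_sub_mul_eq_integral (locallyIntegrable_L2 _) (locallyIntegrable_L2 _)
      (rep_sub_rep u) (rep_sub_rep v) (continuous_rep u) (continuous_rep v) x y)

theorem rep_mulFun (u v : H1) (x : ℝ) : rep (mulFun u v) x = rep u x * rep v x :=
  congrFun (rep_ofPrimitive ((continuous_rep u).mul (continuous_rep v))) x

/-- If `|u| ≤ C |v|` pointwise, then the `L²` norms compare. -/
theorem norm_toL2_le_mul {u v : H1} {C : ℝ} (h : ∀ x, ‖rep u x‖ ≤ C * ‖rep v x‖) :
    ‖toL2 u‖ ≤ C * ‖toL2 v‖ := by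
  refine Lp.norm_le_mul_norm_of_ae_le_mul ?_
  filter_upwards [toL2_ae_eq_rep u, toL2_ae_eq_rep v] with x h1 h2
  rw [h1, h2]
  exact h x

theorem norm_mulFun_le (u v : H1) : ‖mulFun u v‖ ≤ 3 * ‖u‖ * ‖v‖ := by
  have h1 : ‖toL2 (mulFun u v)‖ ≤ ‖u‖ * ‖v‖ := by
    refine (norm_toL2_le_mul (v := v) (C := ‖u‖) fun x => ?_).trans
      (mul_le_mul_of_nonneg_left (norm_toL2_le v) (norm_nonneg _))
    rw [rep_mulFun, norm_mul]
    exact mul_le_mul_of_nonneg_right (norm_rep_le u x) (norm_nonneg _)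
  have hm1 := (memLp_continuous_mul (continuous_rep v) (norm_rep_le v) (Lp.memLp (derivL2 u)))
  have hm2 := (memLp_continuous_mul (continuous_rep u) (norm_rep_le u) (Lp.memLp (derivL2 v)))
  have h2 : derivL2 (mulFun u v) = hm1.toLp _ + hm2.toLp _ := by
    rw [mulFun, derivL2_ofPrimitive, ← MemLp.toLp_add]
    refine MemLp.toLp_congr _ _ (Eventually.of_forall fun x => ?_)
    simp [mul_comm (rep v x)]
  have h3 : ∀ {a b : H1} (hm : MemLp (fun x => rep a x * derivL2 b x) 2 volume),
      ‖hm.toLp _‖ ≤ ‖a‖ * ‖b‖ := fun {a b} hm => by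
    refine (Lp.norm_le_mul_norm_of_ae_le_mul (g := derivL2 b) (c := ‖a‖) ?_).trans
      (mul_le_mul_of_nonneg_left (norm_derivL2_le b) (norm_nonneg _))
    filter_upwards [hm.coeFn_toLp] with x hx
    rw [hx, norm_mul]
    exact mul_le_mul_of_nonneg_right (norm_rep_le a x) (norm_nonneg _)
  have h4 := norm_add_le (hm1.toLp _) (hm2.toLp _)
  rw [← h2] at h4
  have := norm_le_add (mulFun u v)
  have := h3 hm1
  have := h3 hm2
  linarith

/-- Multiplication on `H¹(ℝ)` as a bounded bilinear map. -/
def mul : H1 →L[ℝ] H1 →L[ℝ] H1 :=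
  LinearMap.mkContinuous₂ (LinearMap.mk₂ ℝ mulFun
    (fun u v w => ext_rep fun x => by simp only [rep_mulFun, rep_add]; ring)
    (fun c u v => ext_rep fun x => by simp only [rep_mulFun, rep_real_smul]; ring)
    (fun u v w => ext_rep fun x => by simp only [rep_mulFun, rep_add]; ring)
    (fun c u v => ext_rep fun x => by simp only [rep_mulFun, rep_real_smul]; ring)) 3
    norm_mulFun_le

theorem rep_mul (u v : H1) (x : ℝ) : rep (mul u v) x = rep u x * rep v x := rep_mulFun u v x

theorem memLp_conj {b : ℝ → ℂ} (hb : MemLp b 2 volume) :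
    MemLp (fun x => conj (b x)) 2 volume :=
  hb.of_le (Complex.continuous_conj.comp_aestronglyMeasurable hb.1)
    (Eventually.of_forall fun x => by simp)

/-- The complex conjugate of an element of `H¹(ℝ)`. -/
def conjFun (u : H1) : H1 :=
  ofPrimitive (fun x => conj (rep u x)) (fun x => conj (derivL2 u x)) (memLp_conj (memLp_rep u))
    (memLp_conj (Lp.memLp _)) (conj_rep_sub u)

theorem rep_conjFun (u : H1) (x : ℝ) : rep (conjFun u) x = conj (rep u x) :=
  congrFun (rep_ofPrimitive (Complex.continuous_conj.comp (continuous_rep u))) x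

theorem norm_conjFun_le (u : H1) : ‖conjFun u‖ ≤ 2 * ‖u‖ := by
  have h1 : ‖toL2 (conjFun u)‖ ≤ 1 * ‖toL2 u‖ :=
    norm_toL2_le_mul fun x => by rw [rep_conjFun]; simp
  have h2 : ‖derivL2 (conjFun u)‖ ≤ 1 * ‖derivL2 u‖ := by
    refine Lp.norm_le_mul_norm_of_ae_le_mul ?_
    rw [conjFun, derivL2_ofPrimitive]
    filter_upwards [(memLp_conj (Lp.memLp (derivL2 u))).coeFn_toLp] with x hx
    rw [hx]; simp
  linarith [norm_le_add (conjFun u), norm_toL2_le u, norm_derivL2_le u]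

/-- Complex conjugation on `H¹(ℝ)` as a bounded real-linear map. -/
def conjL : H1 →L[ℝ] H1 :=
  LinearMap.mkContinuous
    { toFun := conjFun
      map_add' := fun u v => ext_rep fun x => by simp only [rep_conjFun, rep_add, map_add]
      map_smul' := fun c u => ext_rep fun x => by
        simp only [rep_conjFun, rep_real_smul, map_mul, Complex.conj_ofReal, RingHom.id_apply] }
    2 norm_conjFun_le

theorem rep_conjL (u : H1) (x : ℝ) : rep (conjL u) x = conj (rep u x) := rep_conjFun u x

end H1

/-! ### Unitary groups generated by inverses of injective self-adjoint operators -/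

/-- The function `r ↦ rⁿ e^{-it/r}`. At `r = 0` the convention `t / 0 = 0` gives the value `0ⁿ`,
which for `n ≥ 1` is the continuous extension. -/
def oscPow (n : ℕ) (t r : ℝ) : ℂ := (r : ℂ) ^ n * Complex.exp (((-(t / r) : ℝ) : ℂ) * Complex.I)

theorem norm_oscPow (n : ℕ) (t r : ℝ) : ‖oscPow n t r‖ = |r| ^ n := by
  rw [oscPow, norm_mul, Complex.norm_exp_ofReal_mul_I, norm_pow, Complex.norm_real, mul_one,
    Real.norm_eq_abs]

theorem oscPow_mul (n k : ℕ) (t s r : ℝ) :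
    oscPow n t r * oscPow k s r = oscPow (n + k) (t + s) r := by
  have : ((-((t + s) / r) : ℝ) : ℂ) * Complex.I
      = ((-(t / r) : ℝ) : ℂ) * Complex.I + ((-(s / r) : ℝ) : ℂ) * Complex.I := by
    push_cast; ring
  simp only [oscPow]
  rw [this, Complex.exp_add, pow_add]
  ring

theorem star_oscPow (n : ℕ) (t r : ℝ) : star (oscPow n t r) = oscPow n (-t) r := by
  simp only [oscPow, star_mul', star_pow, Complex.star_def, Complex.conj_ofReal,
    ← Complex.exp_conj, map_mul, Complex.conj_I]
  congr 2
  push_cast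
  ring

theorem continuous_oscPow {n : ℕ} (hn : n ≠ 0) (t : ℝ) : Continuous (oscPow n t) := by
  rw [continuous_iff_continuousAt]
  intro r
  by_cases hr : r = 0
  · subst hr
    rw [ContinuousAt]
    have h0 : oscPow n t 0 = 0 := by simp [oscPow, hn]
    rw [h0, tendsto_zero_iff_norm_tendsto_zero]
    simp only [norm_oscPow]
    have : Continuous fun x : ℝ => |x| ^ n := by fun_prop
    simpa [hn] using this.tendsto 0
  · unfold oscPow
    have : ContinuousAt (fun r : ℝ => -(t / r)) r :=
      (continuousAt_const.div continuousAt_id hr).neg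
    exact ((Complex.continuous_ofReal.continuousAt).pow n).mul
      ((Complex.continuous_ofReal.continuousAt.comp this).mul continuousAt_const).cexp

theorem norm_exp_mul_I_sub_one_sub_le (x : ℝ) :
    ‖Complex.exp (x * Complex.I) - 1 - x * Complex.I‖ ≤ 3 * x ^ 2 := by
  have hx : ‖(x : ℂ) * Complex.I‖ = |x| := by simp
  by_cases h : |x| ≤ 1
  · have := Complex.norm_exp_sub_one_sub_id_le (x := (x : ℂ) * Complex.I) (by rw [hx]; exact h)
    rw [hx, sq_abs] at this
    nlinarith [sq_nonneg x]
  · have h1 : ‖Complex.exp (x * Complex.I) - 1 - x * Complex.I‖ ≤ 1 + 1 + |x| := by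
      refine (norm_sub_le _ _).trans ?_
      rw [hx]
      gcongr
      refine (norm_sub_le _ _).trans ?_
      rw [Complex.norm_exp_ofReal_mul_I, norm_one]
    rw [← sq_abs]
    nlinarith

/-- Second order Taylor estimate in `t`, uniform in `r`: each time derivative costs a factor `1/r`,
and two powers of `r` pay for the remainder. -/
theorem norm_oscPow_sub_sub_le (n : ℕ) (t s r : ℝ) :
    ‖oscPow (n + 2) t r - oscPow (n + 2) s r - (t - s) • (-Complex.I * oscPow (n + 1) s r)‖
      ≤ 3 * |r| ^ n * (t - s) ^ 2 := by
  by_cases hr : r = 0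
  · subst hr
    simp only [oscPow, Complex.ofReal_zero]
    simp
    positivity
  have hrC : (r : ℂ) ≠ 0 := by exact_mod_cast hr
  have key : oscPow (n + 2) t r - oscPow (n + 2) s r - (t - s) • (-Complex.I * oscPow (n + 1) s r)
      = oscPow (n + 2) s r * (Complex.exp (((-((t - s) / r) : ℝ) : ℂ) * Complex.I) - 1
          - ((-((t - s) / r) : ℝ) : ℂ) * Complex.I) := by
    have e1 : oscPow (n + 2) t r
        = oscPow (n + 2) s r * Complex.exp (((-((t - s) / r) : ℝ) : ℂ) * Complex.I) := by
      simp only [oscPow]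
      rw [mul_assoc, ← Complex.exp_add]
      congr 2
      push_cast
      ring
    have e2 : oscPow (n + 2) s r = r * oscPow (n + 1) s r := by simp only [oscPow]; ring
    rw [e1, e2, Complex.real_smul]
    push_cast
    field_simp
  rw [key, norm_mul, norm_oscPow]
  calc |r| ^ (n + 2) * _ ≤ |r| ^ (n + 2) * (3 * (-((t - s) / r)) ^ 2) := by
        gcongr; exact norm_exp_mul_I_sub_one_sub_le _
    _ = 3 * |r| ^ n * (t - s) ^ 2 := by
        rw [pow_add, sq_abs]; field_simp

section Group

variable {V : Type*} [NormedAddCommGroup V] [InnerProductSpace ℂ V] [CompleteSpace V]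

/-- The operator `Rⁿ e^{-itR⁻¹}`, for a self-adjoint operator `R`. -/
def oscOp (R : V →L[ℂ] V) (n : ℕ) (t : ℝ) : V →L[ℂ] V := cfc (fun z : ℂ => oscPow n t z.re) R

variable {R : V →L[ℂ] V}

theorem oscOp_mul {n k : ℕ} (hn : n ≠ 0) (hk : k ≠ 0) (t s : ℝ) :
    oscOp R n t * oscOp R k s = oscOp R (n + k) (t + s) := by
  have h1 := ((continuous_oscPow hn t).comp Complex.continuous_re).continuousOn (s := spectrum ℂ R)
  have h2 := ((continuous_oscPow hk s).comp Complex.continuous_re).continuousOn (s := spectrum ℂ R)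
  have := cfc_mul _ _ R h1 h2
  simp only [Function.comp_def, oscPow_mul] at this
  exact this.symm

theorem star_oscOp (n : ℕ) (t : ℝ) : star (oscOp R n t) = oscOp R n (-t) := by
  simp only [oscOp, ← cfc_star, star_oscPow]

theorem oscOp_zero (hR : IsSelfAdjoint R) (n : ℕ) : oscOp R n 0 = R ^ n := by
  rw [oscOp, ← cfc_pow_id (R := ℂ) R n (ha := hR.isStarNormal)]
  refine cfc_congr fun z hz => ?_
  simp only [oscPow]
  rw [← hR.mem_spectrum_eq_re hz]
  simp

theorem norm_oscOp_apply (hR : IsSelfAdjoint R) {n : ℕ} (hn : n ≠ 0) (t : ℝ) (x : V) :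
    ‖oscOp R n t x‖ = ‖(R ^ n) x‖ := by
  have h : ∀ s, ‖oscOp R n s x‖ ^ 2 = RCLike.re (inner ℂ x (oscOp R (n + n) 0 x)) := fun s => by
    have e : oscOp R (n + n) 0 = ContinuousLinearMap.adjoint (oscOp R n s) * oscOp R n s := by
      rw [← ContinuousLinearMap.star_eq_adjoint, star_oscOp, oscOp_mul hn hn, neg_add_cancel]
    rw [e, mul_apply_eq_comp, ContinuousLinearMap.adjoint_inner_right,
      inner_self_eq_norm_sq]
  have := (h t).trans (h 0).symm
  rw [oscOp_zero hR] at this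
  exact (pow_left_inj₀ (norm_nonneg _) (norm_nonneg _) two_ne_zero).1 this

theorem norm_oscOp_sub_sub_le (n : ℕ) (t s : ℝ) :
    ‖oscOp R (n + 2) t - oscOp R (n + 2) s - (t - s) • (-Complex.I • oscOp R (n + 1) s)‖
      ≤ 3 * ‖R‖ ^ n * (t - s) ^ 2 := by
  have hc : ∀ (k : ℕ) (u : ℝ), k ≠ 0 →
      ContinuousOn (fun z : ℂ => oscPow k u z.re) (spectrum ℂ R) := fun k u hk =>
    ((continuous_oscPow hk u).comp Complex.continuous_re).continuousOn
  have e : oscOp R (n + 2) t - oscOp R (n + 2) s - (t - s) • (-Complex.I • oscOp R (n + 1) s)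
      = cfc (fun z : ℂ => oscPow (n + 2) t z.re - oscPow (n + 2) s z.re
          - (t - s) • (-Complex.I * oscPow (n + 1) s z.re)) R := by
    have c1 := hc (n + 2) t (by omega)
    have c2 := hc (n + 2) s (by omega)
    have c3 := hc (n + 1) s (by omega)
    have c4 : ContinuousOn (fun z : ℂ => -Complex.I * oscPow (n + 1) s z.re) (spectrum ℂ R) :=
      continuousOn_const.mul c3
    have c5 : ContinuousOn (fun z : ℂ => (t - s) • (-Complex.I * oscPow (n + 1) s z.re))
      (spectrum ℂ R) := c4.const_smul (t - s)
    rw [cfc_sub (fun z : ℂ => oscPow (n + 2) t z.re - oscPow (n + 2) s z.re)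
      (fun z => (t - s) • (-Complex.I * oscPow (n + 1) s z.re)) R (c1.sub c2) c5,
      cfc_sub (fun z : ℂ => oscPow (n + 2) t z.re) _ R c1 c2,
      cfc_smul (t - s) (fun z : ℂ => -Complex.I * oscPow (n + 1) s z.re) R c4,
      cfc_const_mul (-Complex.I) (fun z : ℂ => oscPow (n + 1) s z.re) R c3]
    rfl
  rw [e]
  refine norm_cfc_le (by positivity) fun z hz => (norm_oscPow_sub_sub_le _ _ _ _).trans ?_
  gcongr
  have : Nontrivial V := by
    by_contra hV
    rw [not_nontrivial_iff_subsingleton] at hV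
    have : Subsingleton (V →L[ℂ] V) := ⟨fun f g => by ext; exact Subsingleton.elim _ _⟩
    rw [spectrum.of_subsingleton] at hz
    exact hz
  exact (Complex.abs_re_le_norm z).trans (spectrum.norm_le_norm_of_mem hz)

/-- A continuous function is differentiable if its increments are linear up to quadratic errors. -/
theorem hasDerivAt_of_quadratic {E : Type*} [NormedAddCommGroup E] [NormedSpace ℝ E] {f : ℝ → E}
    {f' : E} {t C : ℝ} (h : ∀ s, ‖f s - f t - (s - t) • f'‖ ≤ C * (s - t) ^ 2) :
    HasDerivAt f f' t := by
  rw [hasDerivAt_iff_isLittleO]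
  have h1 : (fun s => f s - f t - (s - t) • f') =O[𝓝 t] fun s => (s - t) ^ 2 :=
    Asymptotics.IsBigO.of_bound C (Eventually.of_forall fun s => by
      rw [Real.norm_eq_abs, abs_of_nonneg (sq_nonneg _)]; exact h s)
  refine h1.trans_isLittleO ?_
  have : (fun s : ℝ => (s - t) ^ 2) = (fun x => x ^ 2) ∘ fun s => s - t := rfl
  rw [this]
  refine (Asymptotics.isLittleO_pow_id (𝕜 := ℝ) one_lt_two).comp_tendsto ?_
  have : Continuous fun s : ℝ => s - t := by fun_prop
  simpa using this.tendsto t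

theorem hasDerivAt_oscOp_apply (n : ℕ) (t : ℝ) (x : V) :
    HasDerivAt (fun s => oscOp R (n + 2) s x) (-Complex.I • oscOp R (n + 1) t x) t := by
  refine hasDerivAt_of_quadratic (C := 3 * ‖R‖ ^ n * ‖x‖) fun s => ?_
  calc _ = ‖(oscOp R (n + 2) s - oscOp R (n + 2) t
        - (s - t) • (-Complex.I • oscOp R (n + 1) t)) x‖ := by simp
    _ ≤ (3 * ‖R‖ ^ n * (s - t) ^ 2) * ‖x‖ :=
        (ContinuousLinearMap.le_opNorm _ _).trans
          (mul_le_mul_of_nonneg_right (norm_oscOp_sub_sub_le n s t) (norm_nonneg _))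
    _ = _ := by ring

theorem denseRange_of_isSelfAdjoint_injective (hR : IsSelfAdjoint R)
    (hinj : Function.Injective R) : DenseRange R := by
  have h := ContinuousLinearMap.orthogonal_range R
  rw [ContinuousLinearMap.isSelfAdjoint_iff'.1 hR, LinearMap.ker_eq_bot.2 hinj,
    ← Submodule.topologicalClosure_eq_top_iff] at h
  exact Submodule.dense_iff_topologicalClosure_eq_top.2 h

omit [CompleteSpace V] in
theorem denseRange_pow (hR : DenseRange R) (n : ℕ) : DenseRange (R ^ n : V →L[ℂ] V) := by
  induction n with
  | zero => exact Function.surjective_id.denseRange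
  | succ n ih =>
    rw [pow_succ']
    exact hR.comp ih R.continuous

/-- A strongly continuous unitary group `U(t) = e^{-itR⁻¹}` on a Hilbert space `V`, for an
injective self-adjoint `R`. Its generator is recorded in the bounded form `(R U(t) x)' = -i U(t) x`,
valid for every `x`. -/
theorem exists_unitary_group (hR : IsSelfAdjoint R) (hinj : Function.Injective R) :
    ∃ U : ℝ → V →L[ℂ] V, U 0 = 1 ∧ (∀ t s, U (t + s) = U t * U s) ∧
      (∀ t x, ‖U t x‖ = ‖x‖) ∧ (∀ x, Continuous fun t => U t x) ∧
      ∀ t x, HasDerivAt (fun s => R (U s x)) (-Complex.I • U t x) t := by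
  have hd : ∀ n, DenseRange (R ^ n : V →L[ℂ] V) :=
    denseRange_pow (denseRange_of_isSelfAdjoint_injective hR hinj)
  -- two continuous maps that agree on the range of `Rⁿ` are equal
  have hext : ∀ n (f g : V → V), Continuous f → Continuous g →
      (∀ x, f ((R ^ n) x) = g ((R ^ n) x)) → f = g := fun n f g hf hg h =>
    (hd n).equalizer hf hg (funext h)
  -- `oscOp R n` is norm differentiable only for `n ≥ 2`, so `U t` is defined as the isometric
  -- extension of `R² x ↦ oscOp R 2 t x`
  set U : ℝ → V →L[ℂ] V := fun t =>
    (oscOp R 2 t : V →ₗ[ℂ] V).extendOfNorm ((R ^ 2 : V →L[ℂ] V) : V →ₗ[ℂ] V) with hU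
  have hU2 : ∀ t x, U t ((R ^ 2) x) = oscOp R 2 t x := fun t x =>
    LinearMap.extendOfNorm_eq (f := (oscOp R 2 t : V →ₗ[ℂ] V))
      (e := ((R ^ 2 : V →L[ℂ] V) : V →ₗ[ℂ] V)) (hd 2)
      ⟨1, fun x => by rw [one_mul]; exact (norm_oscOp_apply hR two_ne_zero t x).le⟩ x
  have hnorm : ∀ t x, ‖U t x‖ = ‖x‖ := fun t x => by
    refine (hd 2).induction_on (p := fun x => ‖U t x‖ = ‖x‖) x
      (isClosed_eq (by fun_prop) (by fun_prop)) fun x => ?_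
    rw [hU2, norm_oscOp_apply hR two_ne_zero]
  have hzero : U 0 = 1 := by
    ext x
    refine congrFun (hext 2 (U 0) id (U 0).continuous continuous_id fun x => ?_) x
    rw [hU2, oscOp_zero hR]; rfl
  have hadd : ∀ t s, U (t + s) = U t * U s := fun t s => by
    ext x
    refine congrFun (hext (2 + 2) (U (t + s)) (U t * U s : V →L[ℂ] V)
      (ContinuousLinearMap.continuous _) (ContinuousLinearMap.continuous _) fun x => ?_) x
    have e : oscOp R 2 s ((R ^ 2) x) = (R ^ 2) (oscOp R 2 s x) := by
      rw [← oscOp_zero hR, ← mul_apply_eq_comp, ← mul_apply_eq_comp,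
        oscOp_mul two_ne_zero two_ne_zero, oscOp_mul two_ne_zero two_ne_zero, add_comm s]
    rw [pow_add, mul_apply_eq_comp, mul_apply_eq_comp, hU2, hU2, e, hU2, ← oscOp_zero hR,
      ← mul_apply_eq_comp, ← mul_apply_eq_comp,
      oscOp_mul two_ne_zero two_ne_zero, oscOp_mul two_ne_zero two_ne_zero, add_zero,
      add_comm t]
  have hcont2 : ∀ x, Continuous fun t => U t ((R ^ 2) x) := fun x => by
    simp only [hU2]
    exact continuous_iff_continuousAt.2 fun t => (hasDerivAt_oscOp_apply 0 t x).continuousAt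
  have hcont : ∀ x, Continuous fun t => U t x := fun x => by
    rw [Metric.continuous_iff]
    intro t ε hε
    obtain ⟨y, hy⟩ := (hd 2).exists_dist_lt x (show 0 < ε / 3 by positivity)
    obtain ⟨δ, hδ, h⟩ := Metric.continuous_iff.1 (hcont2 y) t (ε / 3) (by positivity)
    refine ⟨δ, hδ, fun s hs => ?_⟩
    have h1 : ∀ r, dist (U r x) (U r ((R ^ 2) y)) < ε / 3 := fun r => by
      rw [dist_eq_norm, ← map_sub, hnorm, ← dist_eq_norm]; exact hy
    calc dist (U s x) (U t x) ≤ dist (U s x) (U s ((R ^ 2) y))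
          + dist (U s ((R ^ 2) y)) (U t ((R ^ 2) y)) + dist (U t ((R ^ 2) y)) (U t x) :=
        dist_triangle4 _ _ _ _
      _ < ε / 3 + ε / 3 + ε / 3 := by
        gcongr
        · exact h1 s
        · exact h s hs
        · rw [dist_comm]; exact h1 t
      _ = ε := by ring
  refine ⟨U, hzero, hadd, hnorm, hcont, fun t x => ?_⟩
  -- the integrated form of the derivative passes to the limit from the range of `R²`
  have hint : ∀ t x, R (U t x) = R x + ∫ s in (0 : ℝ)..t, -Complex.I • U s x := fun t x => by
    have hI : ∀ x, IntervalIntegrable (fun s => -Complex.I • U s x) volume 0 t := fun x =>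
      ((hcont x).const_smul _).intervalIntegrable _ _
    have hc : Continuous fun x => ∫ s in (0 : ℝ)..t, -Complex.I • U s x := by
      refine (LipschitzWith.of_dist_le_mul (K := Real.nnabs t) fun x y => ?_).continuous
      rw [dist_eq_norm, ← intervalIntegral.integral_sub (hI x) (hI y)]
      refine (intervalIntegral.norm_integral_le_of_norm_le_const (C := dist x y)
        fun s _ => ?_).trans (by simp [mul_comm])
      rw [← smul_sub, ← map_sub, norm_smul, hnorm, dist_eq_norm]
      simp
    refine congrFun (hext 2 (fun x => R (U t x))
      (fun x => R x + ∫ s in (0 : ℝ)..t, -Complex.I • U s x) (by fun_prop)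
      (R.continuous.add hc) fun x => ?_) x
    have hI2 := hI ((R ^ 2) x)
    simp only [hU2] at hI2
    have hRU : ∀ s, R (U s ((R ^ 2) x)) = oscOp R 3 s x := fun s => by
      have : R = oscOp R 1 0 := by rw [oscOp_zero hR, pow_one]
      rw [hU2]
      conv_lhs => enter [1]; rw [this]
      rw [← mul_apply_eq_comp, oscOp_mul one_ne_zero two_ne_zero, zero_add]
    have hFTC := intervalIntegral.integral_eq_sub_of_hasDerivAt (a := 0) (b := t)
      (fun s _ => hasDerivAt_oscOp_apply 1 s x) hI2
    have h0 : R ((R ^ 2) x) = oscOp R 3 0 x := by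
      rw [← hRU 0, hzero]; rfl
    have h1 := hRU t
    rw [hU2] at h1
    simp only [hU2, h0, h1, hFTC, Nat.reduceAdd]
    abel
  have hfun : (fun s => R (U s x)) = fun t => R x + ∫ s in (0 : ℝ)..t, -Complex.I • U s x :=
    funext fun t => hint t x
  have hc : Continuous fun s => -Complex.I • U s x := (hcont x).const_smul _
  rw [hfun]
  exact (intervalIntegral.integral_hasDerivAt_right (hc.intervalIntegrable _ _)
    (hc.stronglyMeasurableAtFilter _ _) hc.continuousAt).const_add _

end Group

/-! ### The linear Schrödinger group on the form domain -/

/-- Let `⟨x, S y⟩` be a coercive form on a Hilbert space `V` and let `Q` be an injective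
self-adjoint operator, for instance the Gram operator of a weaker inner product. Then
`Q u' = -i S u` is solved by a strongly continuous group that preserves the form.

With `T = S^{1/2}`, it is the conjugate by `T` of the unitary group generated by the inverse of
`T⁻¹ Q T⁻¹`. -/
theorem exists_form_group {V : Type*} [NormedAddCommGroup V] [InnerProductSpace ℂ V]
    [CompleteSpace V] {S Q : V →L[ℂ] V} (hS : IsSelfAdjoint S) {c : ℝ} (hc : 0 < c)
    (hSc : ∀ x, c * ‖x‖ ^ 2 ≤ RCLike.re (inner ℂ x (S x))) (hQ : IsSelfAdjoint Q)
    (hinj : Function.Injective Q) :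
    ∃ U : ℝ → V →L[ℂ] V, U 0 = 1 ∧ (∀ t s, U (t + s) = U t * U s) ∧
      (∀ t x y, inner ℂ (U t x) (S (U t y)) = inner ℂ x (S y)) ∧
      (∀ x, Continuous fun t => U t x) ∧
      ∀ t x, HasDerivAt (fun s => Q (U s x)) (-Complex.I • S (U t x)) t := by
  have hpos : 0 ≤ S := by
    rw [ContinuousLinearMap.nonneg_iff_isPositive, ContinuousLinearMap.isPositive_def']
    refine ⟨hS, fun x => ?_⟩
    rw [ContinuousLinearMap.reApplyInnerSelf_apply, inner_re_symm]
    exact (by positivity : 0 ≤ c * ‖x‖ ^ 2).trans (hSc x)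
  have hunit : IsUnit S := by
    refine ContinuousLinearMap.isUnit_of_forall_le_norm_inner_map S (c := ⟨c, hc.le⟩) hc fun x => ?_
    rw [norm_inner_symm, mul_comm]
    exact (hSc x).trans (RCLike.re_le_norm _)
  set T : V →L[ℂ] V := CFC.sqrt S with hT
  have hTT : T * T = S := CFC.sqrt_mul_sqrt_self S hpos
  have hTsa : IsSelfAdjoint T := (CFC.sqrt_nonneg S).isSelfAdjoint
  obtain ⟨T', hT'⟩ := (CFC.isUnit_sqrt_iff S hpos).2 hunit
  rw [← hT] at hT'
  set W : V →L[ℂ] V := ↑T'⁻¹ with hW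
  have hTW : T * W = 1 := by rw [← hT']; exact T'.mul_inv
  have hWT : W * T = 1 := by rw [← hT']; exact T'.inv_mul
  have hTWx : ∀ x, T (W x) = x := fun x => DFunLike.congr_fun hTW x
  have hWTx : ∀ x, W (T x) = x := fun x => DFunLike.congr_fun hWT x
  have hWsa : IsSelfAdjoint W := by
    have h1 : star W * T = 1 := by
      have := congrArg star hTW
      rwa [star_mul, hTsa.star_eq, star_one] at this
    calc star W = star W * (T * W) := by rw [hTW, mul_one]
      _ = W := by rw [← mul_assoc, h1, one_mul]
  have hR : IsSelfAdjoint (W * Q * W) := by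
    rw [IsSelfAdjoint, star_mul, star_mul, hWsa.star_eq, hQ.star_eq, mul_assoc]
  have hRinj : Function.Injective (W * Q * W : V →L[ℂ] V) := by
    have hWi : Function.Injective W := Function.LeftInverse.injective hTWx
    exact (hWi.comp hinj).comp hWi
  obtain ⟨U, h0, hadd, hnorm, hcont, hder⟩ := exists_unitary_group hR hRinj
  have hinner : ∀ t x y, inner ℂ (U t x) (U t y) = inner ℂ x y := fun t =>
    (LinearMap.norm_map_iff_inner_map_map (U t)).1 (hnorm t)
  have hSx : ∀ x, S x = T (T x) := fun x => by rw [← hTT]; rfl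
  have hTin : ∀ x y, inner ℂ x (T y) = inner ℂ (T x) y := fun x y => by
    rw [← ContinuousLinearMap.adjoint_inner_left, ContinuousLinearMap.isSelfAdjoint_iff'.1 hTsa]
  refine ⟨fun t => W * U t * T, ?_, fun t s => ?_, fun t x y => ?_, fun x => ?_, fun t x => ?_⟩
  · simp only [h0, mul_one, hWT]
  · simp only [hadd]
    calc W * (U t * U s) * T = W * U t * 1 * U s * T := by simp only [mul_one, mul_assoc]
      _ = _ := by rw [← hTW]; simp only [mul_assoc]
  · simp only [mul_apply_eq_comp, hSx, hTWx]
    rw [hTin, hTWx, hinner, hTin, hTin x, hTin (T x)]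
  · exact W.continuous.comp (hcont _)
  · have h := (T.restrictScalars ℝ).hasFDerivAt.comp_hasDerivAt t (hder t (T x))
    have e1 : ∀ s, T ((W * Q * W : V →L[ℂ] V) (U s (T x))) = Q ((W * U s * T : V →L[ℂ] V) x) :=
      fun s => by simp only [mul_apply_eq_comp, hTWx]
    have e2 : T (-Complex.I • U t (T x)) = -Complex.I • S ((W * U t * T : V →L[ℂ] V) x) := by
      simp only [mul_apply_eq_comp, hSx, hTWx, map_smul]
    convert h using 1
    · funext s; exact (e1 s).symm
    · exact e2.symm

namespace H1

/-- The Gram operator of the `L²` inner product on `H¹(ℝ)`: `⟨u, Q v⟩_{H¹} = ⟨u, v⟩_{L²}`. -/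
def gramL2 : H1 →L[ℂ] H1 := ContinuousLinearMap.adjoint toL2 ∘L toL2

/-- A shift that makes the form `A_Z + m` coercive on `H¹(ℝ)`. -/
def shift (Z : ℝ) : ℝ := 2 * Z ^ 2 + 1

/-- The Gram operator on `H¹(ℝ)` of the shifted form `⟨A_Z v, u⟩ + m ⟨v, u⟩_{L²}`. -/
def gramForm (Z : ℝ) : H1 →L[ℂ] H1 :=
  ContinuousLinearMap.adjoint derivL2 ∘L derivL2 + (shift Z : ℂ) • gramL2
    - (Z : ℂ) • (ContinuousLinearMap.adjoint (eval 0) ∘L eval 0)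

theorem inner_gramL2 (u v : H1) : inner ℂ u (gramL2 v) = inner ℂ (toL2 u) (toL2 v) := by
  rw [gramL2, ContinuousLinearMap.comp_apply, ContinuousLinearMap.adjoint_inner_right]

theorem inner_gramForm (Z : ℝ) (u v : H1) : inner ℂ u (gramForm Z v)
    = inner ℂ (derivL2 u) (derivL2 v) + shift Z * inner ℂ (toL2 u) (toL2 v)
      - Z * (rep v 0 * conj (rep u 0)) := by
  simp only [gramForm, sub_apply, add_apply,
    smul_apply, inner_sub_right, inner_add_right, inner_smul_right,
    inner_gramL2, ContinuousLinearMap.comp_apply, ContinuousLinearMap.adjoint_inner_right]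
  rfl

theorem isSelfAdjoint_gramL2 : IsSelfAdjoint gramL2 :=
  (ContinuousLinearMap.isPositive_adjoint_comp_self toL2).isSelfAdjoint

theorem isSelfAdjoint_gramForm (Z : ℝ) : IsSelfAdjoint (gramForm Z) := by
  have h : ∀ (r : ℝ) {A : H1 →L[ℂ] H1}, IsSelfAdjoint A → IsSelfAdjoint ((r : ℂ) • A) :=
    fun r A hA => IsSelfAdjoint.smul (Complex.conj_ofReal r) hA
  exact (((ContinuousLinearMap.isPositive_adjoint_comp_self derivL2).isSelfAdjoint).add
    (h _ isSelfAdjoint_gramL2)).sub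
      (h _ (ContinuousLinearMap.isPositive_adjoint_comp_self (eval 0)).isSelfAdjoint)

theorem gramL2_injective : Function.Injective gramL2 := by
  rw [injective_iff_map_eq_zero]
  intro u hu
  have h := inner_gramL2 u u
  rw [hu, inner_zero_right, eq_comm, inner_self_eq_zero] at h
  exact toL2_injective (h.trans (map_zero toL2).symm)

theorem re_inner_gramForm_self (Z : ℝ) (u : H1) : (inner ℂ u (gramForm Z u)).re
    = ‖derivL2 u‖ ^ 2 + shift Z * ‖toL2 u‖ ^ 2 - Z * ‖rep u 0‖ ^ 2 := by
  rw [inner_gramForm, inner_self_eq_norm_sq_to_K, inner_self_eq_norm_sq_to_K, Complex.mul_conj']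
  have : (‖derivL2 u‖ : ℂ) ^ 2 + shift Z * (‖toL2 u‖ : ℂ) ^ 2 - Z * (‖rep u 0‖ : ℂ) ^ 2
      = ((‖derivL2 u‖ ^ 2 + shift Z * ‖toL2 u‖ ^ 2 - Z * ‖rep u 0‖ ^ 2 : ℝ) : ℂ) := by
    push_cast; rfl
  exact congrArg Complex.re this

theorem gramForm_coercive (Z : ℝ) (u : H1) :
    1 / 2 * ‖u‖ ^ 2 ≤ (inner ℂ u (gramForm Z u)).re := by
  rw [re_inner_gramForm_self, norm_sq_eq, shift]
  have h1 : Z * ‖rep u 0‖ ^ 2 ≤ |Z| * (2 * ‖toL2 u‖ * ‖derivL2 u‖) :=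
    mul_le_mul (le_abs_self Z) (norm_rep_sq_le u 0) (by positivity) (abs_nonneg Z)
  have h2 := sq_abs Z
  nlinarith [sq_nonneg (2 * |Z| * ‖toL2 u‖ - ‖derivL2 u‖), sq_nonneg ‖toL2 u‖]

theorem formA_eq (Z : ℝ) (u v : H1) :
    formA Z u v = inner ℂ v (gramForm Z u) - shift Z * inner ℂ v (gramL2 u) := by
  rw [inner_gramForm, inner_gramL2, formA]
  ring

theorem toHneg1_apply (u v : H1) : toHneg1 u v = inner ℂ v (gramL2 u) :=
  (inner_gramL2 v u).symm

end H1

/-! ### A two-sided Grönwall inequality -/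

/-- Grönwall's inequality for a homogeneous differential inequality on `[-T, T]`. -/
theorem norm_le_exp_of_norm_deriv_le {E : Type*} [NormedAddCommGroup E] [NormedSpace ℝ E]
    {T K : ℝ} {y y' : ℝ → E} (hy : ∀ t ∈ Icc (-T) T, HasDerivWithinAt y (y' t) (Icc (-T) T) t)
    (hK : ∀ t ∈ Icc (-T) T, ‖y' t‖ ≤ K * ‖y t‖) {t : ℝ} (ht : t ∈ Icc (-T) T) :
    ‖y t‖ ≤ ‖y 0‖ * Real.exp (K * |t|) := by
  have hpos : ∀ {y y' : ℝ → E}, (∀ t ∈ Icc (-T) T, HasDerivWithinAt y (y' t) (Icc (-T) T) t) →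
      (∀ t ∈ Icc (-T) T, ‖y' t‖ ≤ K * ‖y t‖) → ∀ t ∈ Icc 0 T,
      ‖y t‖ ≤ ‖y 0‖ * Real.exp (K * t) := by
    intro y y' hy hK t ht
    have h0T : (0 : ℝ) ≤ T := ht.1.trans ht.2
    have hsub : Icc 0 T ⊆ Icc (-T) T := Icc_subset_Icc_left (by linarith)
    have h := norm_le_gronwallBound_of_norm_deriv_right_le (f := y) (f' := y') (δ := ‖y 0‖)
      (K := K) (ε := 0) (a := 0) (b := T)
      (fun s hs => ((hy s (hsub hs)).continuousWithinAt).mono hsub)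
      (fun s hs => (hy s (hsub (Ico_subset_Icc_self hs))).mono_of_mem_nhdsWithin
        (Icc_mem_nhdsGE_of_mem ⟨by linarith [hs.1], hs.2⟩)) le_rfl
      (fun s hs => by rw [add_zero]; exact hK s (hsub (Ico_subset_Icc_self hs))) t ht
    rwa [gronwallBound_ε0, sub_zero] at h
  rcases le_total 0 t with h0 | h0
  · rw [abs_of_nonneg h0]
    exact hpos hy hK t ⟨h0, ht.2⟩
  · rw [abs_of_nonpos h0]
    have hneg : ∀ s ∈ Icc (-T) T, -s ∈ Icc (-T) T := fun s hs => by
      constructor <;> linarith [hs.1, hs.2]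
    have := hpos (y := fun s => y (-s)) (y' := fun s => -y' (-s)) (fun s hs => by
      have h := (hy (-s) (hneg s hs)).scomp s (hasDerivAt_neg s).hasDerivWithinAt
        (fun r hr => hneg r hr)
      simpa [Function.comp_def] using h) (fun s hs => by rw [norm_neg]; exact hK _ (hneg s hs)) (-t)
      ⟨by linarith, by linarith [ht.1]⟩
    simpa using this

/-! ### Semilinear evolution equations: smooth global flows from a priori bounds -/

section Semilinear

variable {V : Type*} [NormedAddCommGroup V] [NormedSpace ℝ V]

/-- A bounded, strongly continuous one-parameter group of operators. -/
structure IsBoundedGroup (U : ℝ → V →L[ℝ] V) : Prop where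
  map_zero : U 0 = 1
  map_add : ∀ t s, U (t + s) = U t * U s
  continuous_apply : ∀ x, Continuous fun t => U t x
  exists_bound : ∃ C : ℝ, 0 ≤ C ∧ ∀ t x, ‖U t x‖ ≤ C * ‖x‖

/-- A nonlinearity `F` on `V` with `F 0 = 0` that is Lipschitz on bounded sets and whose
superposition operators `u ↦ F ∘ u` on the spaces `C([-T, T]; V)` are smooth. -/
structure IsSmoothNonlinearity (F : V → V) : Prop where
  map_zero : F 0 = 0
  continuous : Continuous F
  lipschitz : ∀ M : ℝ, ∃ L : ℝ, 0 ≤ L ∧ ∀ x y, ‖x‖ ≤ M → ‖y‖ ≤ M → ‖F x - F y‖ ≤ L * ‖x - y‖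
  contDiff_comp : ∀ T : ℝ,
    ContDiff ℝ ∞ fun u : C(Icc (-T) T, V) => (⟨F, continuous⟩ : C(V, V)).comp u

/-- `u` is continuous and solves on `[-T, T]` the Duhamel equation
`u(t) = U(t) u₀ + ∫₀ᵗ U(t - s) F(u(s)) ds`. Apart from continuity,
the values of `u` outside `[-T, T]` are irrelevant. -/
def IsMild (U : ℝ → V →L[ℝ] V) (F : V → V) (T : ℝ) (u₀ : V) (u : ℝ → V) : Prop :=
  Continuous u ∧ ∀ t ∈ Icc (-T) T, u t = U t (u₀ + ∫ s in (0 : ℝ)..t, U (-s) (F (u s)))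

variable {U : ℝ → V →L[ℝ] V} {F : V → V}

theorem IsBoundedGroup.tendsto_apply (hU : IsBoundedGroup U) {X : Type*} {l : Filter X}
    {τ : X → ℝ} {g : X → V} {t : ℝ} {x : V} (hτ : Tendsto τ l (𝓝 t)) (hg : Tendsto g l (𝓝 x)) :
    Tendsto (fun y => U (τ y) (g y)) l (𝓝 (U t x)) := by
  obtain ⟨C, hC0, hC⟩ := hU.exists_bound
  have h1 : Tendsto (fun y => U (τ y) (g y - x)) l (𝓝 0) := by
    refine squeeze_zero_norm (fun y => hC _ _) ?_
    simpa using ((hg.sub_const x).norm).const_mul C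
  have h2 : Tendsto (fun y => U (τ y) x) l (𝓝 (U t x)) :=
    ((hU.continuous_apply x).tendsto t).comp hτ
  simpa using h1.add h2

theorem IsBoundedGroup.continuous_comp (hU : IsBoundedGroup U) {X : Type*} [TopologicalSpace X]
    {τ : X → ℝ} {g : X → V} (hτ : Continuous τ) (hg : Continuous g) :
    Continuous fun x => U (τ x) (g x) :=
  continuous_iff_continuousAt.2 fun x => hU.tendsto_apply (hτ.tendsto x) (hg.tendsto x)

theorem IsBoundedGroup.hasDerivAt_apply_of_eq_zero (hU : IsBoundedGroup U) {y : ℝ → V} {y' : V}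
    {t : ℝ} (hy : HasDerivAt y y' t) (h0 : y t = 0) :
    HasDerivAt (fun s => U s (y s)) (U t y') t := by
  rw [hasDerivAt_iff_tendsto_slope] at hy ⊢
  refine (hU.tendsto_apply (tendsto_id.mono_left nhdsWithin_le_nhds) hy).congr fun s => ?_
  simp [slope_def_module, h0]

theorem IsBoundedGroup.apply_neg (hU : IsBoundedGroup U) (t : ℝ) (x : V) : U t (U (-t) x) = x := by
  have := hU.map_add t (-t)
  rw [add_neg_cancel, hU.map_zero] at this
  exact (DFunLike.congr_fun this x).symm

theorem IsMild.mono {T T' : ℝ} {u₀ : V} {u : ℝ → V} (h : IsMild U F T u₀ u) (hT : T' ≤ T) :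
    IsMild U F T' u₀ u :=
  ⟨h.1, fun t ht => h.2 t (Icc_subset_Icc (neg_le_neg hT) hT ht)⟩

theorem IsMild.eq_zero (hU : IsBoundedGroup U) {T : ℝ} (hT : 0 ≤ T) {u₀ : V} {u : ℝ → V}
    (h : IsMild U F T u₀ u) : u 0 = u₀ := by
  rw [h.2 0 ⟨by linarith, hT⟩, hU.map_zero]
  simp

variable [CompleteSpace V]

/-- In the interaction picture `v(t) = U(-t) u(t)` a mild solution is continuously
differentiable. -/
theorem hasDerivAt_interaction (hU : IsBoundedGroup U) (hF : Continuous F) {u : ℝ → V}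
    (hu : Continuous u) (u₀ : V) (t : ℝ) :
    HasDerivAt (fun t => u₀ + ∫ s in (0 : ℝ)..t, U (-s) (F (u s))) (U (-t) (F (u t))) t := by
  have hc : Continuous fun s => U (-s) (F (u s)) := hU.continuous_comp continuous_neg (hF.comp hu)
  exact (intervalIntegral.integral_hasDerivAt_right (hc.intervalIntegrable _ _)
    (hc.stronglyMeasurableAtFilter _ _) hc.continuousAt).const_add _

/-- Lipschitz dependence of bounded mild solutions on the initial value. -/
theorem exists_lipschitz_mild (hU : IsBoundedGroup U) (hF : IsSmoothNonlinearity F) (T M : ℝ) :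
    ∃ K : ℝ, ∀ u₀ w₀ u w, IsMild U F T u₀ u → IsMild U F T w₀ w →
      (∀ t ∈ Icc (-T) T, ‖u t‖ ≤ M) → (∀ t ∈ Icc (-T) T, ‖w t‖ ≤ M) →
      ∀ t ∈ Icc (-T) T, ‖u t - w t‖ ≤ K * ‖u₀ - w₀‖ := by
  obtain ⟨C, hC0, hC⟩ := hU.exists_bound
  obtain ⟨L, hL0, hL⟩ := hF.lipschitz M
  refine ⟨C * Real.exp (C * (L * C) * T), fun u₀ w₀ u w hu hw hub hwb t ht => ?_⟩
  set y : ℝ → V := fun t => (u₀ + ∫ s in (0 : ℝ)..t, U (-s) (F (u s)))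
    - (w₀ + ∫ s in (0 : ℝ)..t, U (-s) (F (w s))) with hy
  have hyt : ∀ t ∈ Icc (-T) T, u t - w t = U t (y t) := fun t ht => by
    rw [hu.2 t ht, hw.2 t ht, ← map_sub]
  have hle : ∀ t ∈ Icc (-T) T, ‖u t - w t‖ ≤ C * ‖y t‖ := fun t ht => by
    rw [hyt t ht]; exact hC _ _
  have hgr := norm_le_exp_of_norm_deriv_le (y := y) (K := C * (L * C)) (T := T)
    (y' := fun t => U (-t) (F (u t)) - U (-t) (F (w t)))
    (fun t _ => ((hasDerivAt_interaction hU hF.continuous hu.1 u₀ t).sub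
      (hasDerivAt_interaction hU hF.continuous hw.1 w₀ t)).hasDerivWithinAt) (fun t ht => by
      rw [← map_sub]
      refine (hC _ _).trans ?_
      rw [mul_assoc, mul_assoc]
      refine mul_le_mul_of_nonneg_left ((hL _ _ (hub t ht) (hwb t ht)).trans ?_) hC0
      exact mul_le_mul_of_nonneg_left (hle t ht) hL0) ht
  have h0 : y 0 = u₀ - w₀ := by simp [hy]
  have htT : |t| ≤ T := abs_le.2 ht
  calc ‖u t - w t‖ ≤ C * ‖y t‖ := hle t ht
    _ ≤ C * (‖u₀ - w₀‖ * Real.exp (C * (L * C) * T)) := by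
        rw [h0] at hgr
        refine mul_le_mul_of_nonneg_left (hgr.trans ?_) hC0
        gcongr
    _ = _ := by ring

omit [NormedSpace ℝ V] [CompleteSpace V] in
theorem exists_bound_Icc {u : ℝ → V} (hu : Continuous u) (T : ℝ) :
    ∃ M : ℝ, ∀ t ∈ Icc (-T) T, ‖u t‖ ≤ M :=
  isCompact_Icc.exists_bound_of_continuousOn hu.continuousOn

theorem IsMild.unique (hU : IsBoundedGroup U) (hF : IsSmoothNonlinearity F) {T : ℝ} {u₀ : V}
    {u w : ℝ → V} (hu : IsMild U F T u₀ u) (hw : IsMild U F T u₀ w) :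
    EqOn u w (Icc (-T) T) := by
  obtain ⟨M, hM⟩ := exists_bound_Icc hu.1 T
  obtain ⟨M', hM'⟩ := exists_bound_Icc hw.1 T
  obtain ⟨K, hK⟩ := exists_lipschitz_mild hU hF T (max M M')
  intro t ht
  have := hK u₀ u₀ u w hu hw (fun t ht => (hM t ht).trans (le_max_left _ _))
    (fun t ht => (hM' t ht).trans (le_max_right _ _)) t ht
  rw [sub_self, norm_zero, mul_zero] at this
  exact sub_eq_zero.1 (norm_le_zero_iff.1 this)

theorem isUnit_one_sub_of_norm_pow_lt_one {A : V →L[ℝ] V} {n : ℕ} (h : ‖A ^ n‖ < 1) :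
    IsUnit (1 - A) := by
  have hu := isUnit_one_sub_of_norm_lt_one h
  rw [← mul_neg_geom_sum] at hu
  exact (((Commute.one_left _).sub_left (Commute.sum_right _ _ _
    fun i _ => (Commute.refl A).pow_right i)).isUnit_mul_iff.1 hu).1

/-- If `A` increases the order of vanishing at `t = 0` in the manner of a Volterra operator, then
`1 - A` is invertible, since `‖Aⁿ‖ ≤ (CT)ⁿ / n!`. -/
theorem isUnit_one_sub_of_volterra {T : ℝ} {A : C(Icc (-T) T, V) →L[ℝ] C(Icc (-T) T, V)} {C : ℝ}
    (hC : 0 ≤ C) (hA : ∀ (w : C(Icc (-T) T, V)) (a : ℝ) (n : ℕ), 0 ≤ a →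
      (∀ s, ‖w s‖ ≤ a * |(s : ℝ)| ^ n) → ∀ t, ‖A w t‖ ≤ C * (a * (|(t : ℝ)| ^ (n + 1) / (n + 1)))) :
    IsUnit (1 - A) := by
  have hpow : ∀ (n : ℕ) (w : C(Icc (-T) T, V)) (t : Icc (-T) T),
      ‖(A ^ n) w t‖ ≤ (C ^ n * ‖w‖ / n.factorial) * |(t : ℝ)| ^ n := by
    intro n
    induction n with
    | zero => intro w t; simpa using w.norm_coe_le_norm t
    | succ n ih =>
      intro w t
      rw [pow_succ', mul_apply_eq_comp]
      refine (hA _ _ n (by positivity) (ih w) t).trans (le_of_eq ?_)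
      rw [Nat.factorial_succ]
      push_cast
      field_simp
      ring
  have hnorm : ∀ n : ℕ, ‖A ^ n‖ ≤ (C * |T|) ^ n / n.factorial := fun n => by
    refine ContinuousLinearMap.opNorm_le_bound _ (by positivity) fun w => ?_
    rw [ContinuousMap.norm_le _ (by positivity)]
    intro t
    refine (hpow n w t).trans ?_
    have ht : |(t : ℝ)| ≤ |T| := (abs_le.2 t.2).trans (le_abs_self T)
    calc (C ^ n * ‖w‖ / n.factorial) * |(t : ℝ)| ^ n
        ≤ (C ^ n * ‖w‖ / n.factorial) * |T| ^ n := by gcongr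
      _ = _ := by rw [mul_pow]; ring
  obtain ⟨n, hn⟩ := ((FloorSemiring.tendsto_pow_div_factorial_atTop (C * |T|)).eventually
    (gt_mem_nhds one_pos)).exists
  exact isUnit_one_sub_of_norm_pow_lt_one (V := C(Icc (-T) T, V)) ((hnorm n).trans_lt hn)

end Semilinear

/-! ### The Duhamel equation on `C([-T, T]; V)` -/

section Duhamel

variable {V : Type*} [NormedAddCommGroup V] [NormedSpace ℝ V] [CompleteSpace V]
  {U : ℝ → V →L[ℝ] V} {F : V → V} {T : ℝ}

omit [CompleteSpace V] in
/-- The linear evolution `x ↦ U(·) x` and the Duhamel operator `f ↦ ∫₀^· U(· - s) f(s) ds` as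
bounded operators into `C([-T, T]; V)`. -/
theorem exists_duhamel_operators (hU : IsBoundedGroup U) (hT : -T ≤ T) :
    ∃ (Λ : V →L[ℝ] C(Icc (-T) T, V)) (K : C(Icc (-T) T, V) →L[ℝ] C(Icc (-T) T, V)) (C : ℝ),
      0 ≤ C ∧ (∀ x t, Λ x t = U t x) ∧
      (∀ f t, K f t = U t (∫ s in (0 : ℝ)..t, U (-s) (IccExtend hT f s))) ∧
      ∀ f a (n : ℕ), 0 ≤ a → (∀ s : Icc (-T) T, ‖f s‖ ≤ a * |(s : ℝ)| ^ n) →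
        ∀ t : Icc (-T) T, ‖K f t‖ ≤ C * (a * (|(t : ℝ)| ^ (n + 1) / (n + 1))) := by
  obtain ⟨C, hC0, hC⟩ := hU.exists_bound
  have hcont : ∀ f : C(Icc (-T) T, V), Continuous fun s => U (-s) (IccExtend hT f s) := fun f =>
    hU.continuous_comp continuous_neg f.continuous.Icc_extend'
  have hint : ∀ (f : C(Icc (-T) T, V)) (t : ℝ),
      IntervalIntegrable (fun s => U (-s) (IccExtend hT f s)) volume 0 t := fun f t =>
    (hcont f).intervalIntegrable _ _
  have hprim : ∀ f : C(Icc (-T) T, V),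
      Continuous fun t => ∫ s in (0 : ℝ)..t, U (-s) (IccExtend hT f s) := fun f =>
    intervalIntegral.continuous_primitive (fun a b => (hcont f).intervalIntegrable a b) 0
  have h0 : (0 : ℝ) ∈ Icc (-T) T := ⟨by linarith, by linarith⟩
  have hest : ∀ (f : C(Icc (-T) T, V)) (a : ℝ) (n : ℕ),
      (∀ s : Icc (-T) T, ‖f s‖ ≤ a * |(s : ℝ)| ^ n) → ∀ t : Icc (-T) T,
      ‖U t (∫ s in (0 : ℝ)..t, U (-s) (IccExtend hT f s))‖
        ≤ C * C * (a * (|(t : ℝ)| ^ (n + 1) / (n + 1))) := by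
    intro f a n hf t
    rw [mul_assoc]
    refine (hC _ _).trans (mul_le_mul_of_nonneg_left ?_ hC0)
    refine intervalIntegral.norm_integral_le_integral_norm_uIoc.trans ?_
    have hle : ∀ s ∈ uIoc (0 : ℝ) t, ‖U (-s) (IccExtend hT f s)‖ ≤ C * a * |s - 0| ^ n := by
      intro s hs
      have hs' : s ∈ Icc (-T) T := uIcc_subset_Icc h0 t.2 (uIoc_subset_uIcc hs)
      rw [IccExtend_of_mem hT f hs', sub_zero, mul_assoc]
      exact (hC _ _).trans (mul_le_mul_of_nonneg_left (hf ⟨s, hs'⟩) hC0)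
    have hi : IntegrableOn (fun s : ℝ => C * a * |s - 0| ^ n) (uIoc 0 (t : ℝ)) := by
      have : Continuous fun s : ℝ => C * a * |s - 0| ^ n := by fun_prop
      exact intervalIntegrable_iff.1 (this.intervalIntegrable 0 (t : ℝ))
    refine (setIntegral_mono_on (intervalIntegrable_iff.1 (hint f t)).norm hi
      measurableSet_uIoc hle).trans (le_of_eq ?_)
    rw [integral_const_mul, integral_pow_abs_sub_uIoc, sub_zero, mul_assoc]
  have hTabs : ∀ t : Icc (-T) T, |(t : ℝ)| ≤ T := fun t => abs_le.2 t.2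
  refine ⟨LinearMap.mkContinuous
      { toFun := fun x => ⟨fun t => U t x, (hU.continuous_apply x).comp continuous_subtype_val⟩
        map_add' := fun x y => by ext t; simp
        map_smul' := fun c x => by ext t; simp } C fun x =>
        (ContinuousMap.norm_le _ (by positivity)).2 fun t => hC _ _,
    LinearMap.mkContinuous
      { toFun := fun f => ⟨fun t => U t (∫ s in (0 : ℝ)..t, U (-s) (IccExtend hT f s)),
          hU.continuous_comp continuous_subtype_val ((hprim f).comp continuous_subtype_val)⟩
        map_add' := fun f g => by
          ext t
          simp only [ContinuousMap.coe_mk, ContinuousMap.add_apply]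
          rw [← map_add, ← intervalIntegral.integral_add (hint f t) (hint g t)]
          simp only [IccExtend, Function.comp_apply, ContinuousMap.add_apply, map_add]
        map_smul' := fun c f => by
          ext t
          simp only [ContinuousMap.coe_mk, ContinuousMap.smul_apply, RingHom.id_apply]
          rw [← map_smul, ← intervalIntegral.integral_smul]
          simp only [IccExtend, Function.comp_apply, ContinuousMap.smul_apply, map_smul] }
      (C * C * T) fun f => by
        have hT0 : 0 ≤ T := by linarith
        refine (ContinuousMap.norm_le _ (by positivity)).2 fun t => ?_
        refine (hest f ‖f‖ 0 (fun s => by simpa using f.norm_coe_le_norm s) t).trans ?_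
        have := hTabs t
        have hf := norm_nonneg f
        calc C * C * (‖f‖ * (|(t : ℝ)| ^ (0 + 1) / ((0 : ℕ) + 1)))
            = C * C * ‖f‖ * |(t : ℝ)| := by push_cast; ring
          _ ≤ C * C * ‖f‖ * T := by gcongr
          _ = _ := by ring,
    C * C, by positivity, fun x t => rfl, fun f t => rfl, fun f a n _ hf t => hest f a n hf t⟩

omit [CompleteSpace V] in
/-- The derivative of a superposition operator is pointwise bounded. -/
theorem exists_bound_fderiv_comp (hF : IsSmoothNonlinearity F) (u : C(Icc (-T) T, V)) :
    ∃ L : ℝ, 0 ≤ L ∧ ∀ w t, ‖fderiv ℝ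
      (fun u : C(Icc (-T) T, V) => (⟨F, hF.continuous⟩ : C(V, V)).comp u) u w t‖ ≤ L * ‖w t‖ := by
  obtain ⟨L, hL0, hL⟩ := hF.lipschitz (‖u‖ + 1)
  refine ⟨L, hL0, fun w t => ?_⟩
  have hd := ((hF.contDiff_comp T).differentiable (by simp) u).hasFDerivAt
  have hline : HasDerivAt (fun ε : ℝ => u + ε • w) w 0 := by
    simpa using ((hasDerivAt_id (0 : ℝ)).smul_const w).const_add u
  have hd' := hd
  rw [show u = u + (0 : ℝ) • w by simp] at hd'
  have h1 := hd'.comp_hasDerivAt (0 : ℝ) hline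
  have h2 := (ContinuousMap.evalCLM ℝ t : C(Icc (-T) T, V) →L[ℝ] V).hasFDerivAt.comp_hasDerivAt
    (0 : ℝ) h1
  rw [show u + (0 : ℝ) • w = u by simp] at h2
  refine h2.le_of_lip' (by positivity) ?_
  have hsmall : ∀ᶠ ε : ℝ in 𝓝 0, ‖u + ε • w‖ ≤ ‖u‖ + 1 := by
    have hc : Continuous fun ε : ℝ => ‖u + ε • w‖ := by fun_prop
    refine (hc.tendsto 0).eventually_le_const ?_
    simp
  filter_upwards [hsmall] with ε hε
  have hb : ‖(u + ε • w) t‖ ≤ ‖u‖ + 1 := (ContinuousMap.norm_coe_le_norm _ t).trans hε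
  have hb0 : ‖u t‖ ≤ ‖u‖ + 1 := (u.norm_coe_le_norm t).trans (by linarith)
  have := hL _ _ hb hb0
  simp only [Function.comp_apply, ContinuousMap.evalCLM_apply, ContinuousMap.comp_apply,
    ContinuousMap.coe_mk, zero_smul, add_zero, sub_zero]
  refine this.trans (le_of_eq ?_)
  simp only [ContinuousMap.add_apply, ContinuousMap.smul_apply, add_sub_cancel_left, norm_smul]
  ring

/-- A mild solution on `[-T, T]` can be continued to a smooth family of mild solutions for nearby
initial values: by the inverse function theorem applied to `u ↦ u - ∫₀^· U(· - s) F(u(s)) ds`,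
whose derivative is the identity minus a Volterra operator. -/
theorem IsMild.exists_contDiffAt_family (hU : IsBoundedGroup U) (hF : IsSmoothNonlinearity F)
    (hT : 0 < T) {u₀ : V} {u : ℝ → V} (hu : IsMild U F T u₀ u) :
    ∃ g : V → C(Icc (-T) T, V), ContDiffAt ℝ ∞ g u₀ ∧
      ∀ᶠ v in 𝓝 u₀, IsMild U F T v (IccExtend (by linarith : -T ≤ T) (g v)) := by
  have hT' : -T ≤ T := by linarith
  obtain ⟨Λ, K, C, hC0, hΛ, hK, hKest⟩ := exists_duhamel_operators hU hT'
  set 𝓕 : C(Icc (-T) T, V) → C(Icc (-T) T, V) :=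
    fun u => (⟨F, hF.continuous⟩ : C(V, V)).comp u with h𝓕
  set N : C(Icc (-T) T, V) → C(Icc (-T) T, V) := fun u => u - K (𝓕 u) with hN
  have h0 : (0 : ℝ) ∈ Icc (-T) T := ⟨by linarith, by linarith⟩
  have hint : ∀ (f : C(Icc (-T) T, V)) (w : ℝ → V), (∀ t : Icc (-T) T, w t = f t) →
      ∀ t : Icc (-T) T, ∫ s in (0 : ℝ)..t, U (-s) (IccExtend hT' (𝓕 f) s)
        = ∫ s in (0 : ℝ)..t, U (-s) (F (w s)) := by
    intro f w hw t
    refine intervalIntegral.integral_congr fun s hs => ?_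
    have hs' : s ∈ Icc (-T) T := uIcc_subset_Icc h0 t.2 hs
    rw [IccExtend_of_mem hT' _ hs']
    have := hw ⟨s, hs'⟩
    simp only at this
    rw [this]
    rfl
  have hmild : ∀ (f : C(Icc (-T) T, V)) (w : ℝ → V) (v : V), Continuous w →
      (∀ t : Icc (-T) T, w t = f t) → (IsMild U F T v w ↔ N f = Λ v) := by
    intro f w v hwc hw
    have hNt : ∀ t, N f t = Λ v t ↔
        w t = U t (v + ∫ s in (0 : ℝ)..t, U (-s) (F (w s))) := fun t => by
      simp only [hN, ContinuousMap.sub_apply, hΛ, hK]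
      rw [hint f w hw t, hw t, map_add, sub_eq_iff_eq_add]
    refine ⟨fun h => ?_, fun h => ⟨hwc, fun t ht => ?_⟩⟩
    · ext t
      exact (hNt t).2 (h.2 t t.2)
    · exact (hNt ⟨t, ht⟩).1 (by rw [h])
  have hNs : ContDiff ℝ ∞ N := contDiff_id.sub (K.contDiff.comp (hF.contDiff_comp T))
  set f : C(Icc (-T) T, V) := ⟨fun t => u t, hu.1.comp continuous_subtype_val⟩ with hf
  have hNf : N f = Λ u₀ := (hmild f u u₀ hu.1 fun t => rfl).1 hu
  set D := fderiv ℝ 𝓕 f with hD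
  obtain ⟨L, hL0, hL⟩ := exists_bound_fderiv_comp hF f
  have hunit : IsUnit (1 - K ∘L D) := by
    refine isUnit_one_sub_of_volterra (C := C * L) (by positivity) fun w a n ha hw t => ?_
    rw [ContinuousLinearMap.comp_apply]
    refine (hKest (D w) (L * a) n (by positivity) (fun s => ?_) t).trans (le_of_eq (by ring))
    rw [mul_assoc]
    exact (hL w s).trans (mul_le_mul_of_nonneg_left (hw s) hL0)
  obtain ⟨E, hE⟩ := hunit
  have hderiv : HasFDerivAt N
      ((ContinuousLinearEquiv.unitsEquiv ℝ _ E : C(Icc (-T) T, V) ≃L[ℝ] C(Icc (-T) T, V)) :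
        C(Icc (-T) T, V) →L[ℝ] C(Icc (-T) T, V)) f := by
    have h1 : HasFDerivAt 𝓕 D f := ((hF.contDiff_comp T).differentiable (by simp) f).hasFDerivAt
    have h2 := (hasFDerivAt_id (𝕜 := ℝ) f).sub (K.hasFDerivAt.comp f h1)
    have h3 : ((ContinuousLinearEquiv.unitsEquiv ℝ _ E :
        C(Icc (-T) T, V) ≃L[ℝ] C(Icc (-T) T, V)) : C(Icc (-T) T, V) →L[ℝ] C(Icc (-T) T, V))
        = 1 - K ∘L D := by rw [← hE]; rfl
    rw [h3]
    exact h2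
  have hn : (∞ : WithTop ℕ∞) ≠ 0 := by simp
  set e := hNs.contDiffAt.toOpenPartialHomeomorph N hderiv hn with he
  refine ⟨fun v => e.symm (Λ v), ?_, ?_⟩
  · have h1 : ContDiffAt ℝ ∞ e.symm (N f) := hNs.contDiffAt.to_localInverse hderiv hn
    rw [hNf] at h1
    exact h1.comp u₀ Λ.contDiff.contDiffAt
  · have hmem : Λ u₀ ∈ e.target := by
      rw [← hNf]
      exact hNs.contDiffAt.image_mem_toOpenPartialHomeomorph_target hderiv hn
    filter_upwards [Λ.continuous.continuousAt.preimage_mem_nhds (e.open_target.mem_nhds hmem)]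
      with v hv
    rw [hmild (e.symm (Λ v)) _ v (ContinuousMap.continuous _).Icc_extend'
      fun t => IccExtend_val hT' _ t]
    exact e.right_inv hv

omit [CompleteSpace V] in
/-- A limit of mild solutions is a mild solution. -/
theorem isMild_of_tendsto (hU : IsBoundedGroup U) (hF : IsSmoothNonlinearity F)
    (hT : 0 < T) {u₀ : V} {x : ℕ → V} {f : ℕ → C(Icc (-T) T, V)} {g : C(Icc (-T) T, V)}
    (hf : ∀ n, IsMild U F T (x n) (IccExtend (by linarith : -T ≤ T) (f n)))
    (hx : Tendsto x atTop (𝓝 u₀)) (hg : Tendsto f atTop (𝓝 g)) :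
    IsMild U F T u₀ (IccExtend (by linarith : -T ≤ T) g) := by
  have hT' : -T ≤ T := by linarith
  obtain ⟨Λ, K, -, -, hΛ, hK, -⟩ := exists_duhamel_operators hU hT'
  have hcomp : ∀ f : C(Icc (-T) T, V),
      IccExtend hT' ((⟨F, hF.continuous⟩ : C(V, V)).comp f) = fun s => F (IccExtend hT' f s) :=
    fun f => rfl
  refine ⟨g.continuous.Icc_extend', fun t ht => ?_⟩
  have h1 : Tendsto (fun n => f n ⟨t, ht⟩) atTop (𝓝 (g ⟨t, ht⟩)) :=
    ((continuous_eval_const (⟨t, ht⟩ : Icc (-T) T)).tendsto g).comp hg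
  have h2 : Tendsto (fun n => Λ (x n) ⟨t, ht⟩ + K ((⟨F, hF.continuous⟩ : C(V, V)).comp (f n))
      ⟨t, ht⟩) atTop (𝓝 (Λ u₀ ⟨t, ht⟩ + K ((⟨F, hF.continuous⟩ : C(V, V)).comp g) ⟨t, ht⟩)) := by
    refine Tendsto.add ?_ ?_
    · exact ((continuous_eval_const (⟨t, ht⟩ : Icc (-T) T)).tendsto _).comp
        ((Λ.continuous.tendsto _).comp hx)
    · exact ((continuous_eval_const (⟨t, ht⟩ : Icc (-T) T)).tendsto _).comp
        ((K.continuous.tendsto _).comp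
          (((hF.contDiff_comp T).continuous.tendsto g).comp hg))
  have h3 : ∀ n, f n ⟨t, ht⟩ = Λ (x n) ⟨t, ht⟩
      + K ((⟨F, hF.continuous⟩ : C(V, V)).comp (f n)) ⟨t, ht⟩ := fun n => by
    have := (hf n).2 t ht
    rw [IccExtend_of_mem hT' _ ht] at this
    rw [this, hΛ, hK, map_add, hcomp]
  simp only [← h3] at h2
  rw [IccExtend_of_mem hT' _ ht, tendsto_nhds_unique h1 h2, hΛ, hK, map_add, hcomp]

/-- Existence of mild solutions on `[-T, T]` from an a priori bound along the segment from `0` to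
the initial value: the parameters `s` for which the initial value `s u₀` is admissible form an open
and closed subset of `[0, 1]`. -/
theorem exists_isMild_of_bound (hU : IsBoundedGroup U) (hF : IsSmoothNonlinearity F)
    (hT : 0 < T) {u₀ : V} {M : ℝ} (hM : ∀ s ∈ Icc (0 : ℝ) 1, ∀ u, IsMild U F T (s • u₀) u →
      ∀ t ∈ Icc (-T) T, ‖u t‖ ≤ M) :
    ∃ u, IsMild U F T u₀ u := by
  have hT' : -T ≤ T := by linarith
  set A : Set ℝ := {s | ∃ u, IsMild U F T (s • u₀) u} with hA
  obtain ⟨K, hK⟩ := exists_lipschitz_mild hU hF T M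
  have hclosed : IsClosed (A ∩ Icc 0 1) := by
    refine IsSeqClosed.isClosed fun s a hs ha => ?_
    have ha01 : a ∈ Icc (0 : ℝ) 1 := isClosed_Icc.mem_of_tendsto ha
      (Eventually.of_forall fun n => (hs n).2)
    choose u hu using fun n => (hs n).1
    set f : ℕ → C(Icc (-T) T, V) := fun n =>
      ⟨fun t => u n t, (hu n).1.comp continuous_subtype_val⟩ with hf
    have hfu : ∀ n, ∀ t ∈ Icc (-T) T, IccExtend hT' (f n) t = u n t := fun n t ht => by
      rw [IccExtend_of_mem hT' _ ht]; rfl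
    have h0 : (0 : ℝ) ∈ Icc (-T) T := ⟨by linarith, by linarith⟩
    have hfm : ∀ n, IsMild U F T (s n • u₀) (IccExtend hT' (f n)) := fun n => by
      refine ⟨(f n).continuous.Icc_extend', fun t ht => ?_⟩
      rw [hfu n t ht, (hu n).2 t ht]
      congr 2
      refine intervalIntegral.integral_congr fun r hr => ?_
      rw [hfu n r (uIcc_subset_Icc h0 ht hr)]
    have hcauchy : CauchySeq f := by
      have hs' : CauchySeq fun n => K * ‖u₀‖ * s n := (ha.const_mul _).cauchySeq
      rw [Metric.cauchySeq_iff] at hs' ⊢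
      intro ε hε
      obtain ⟨n₀, hn₀⟩ := hs' (ε / 2) (by positivity)
      refine ⟨n₀, fun m hm n hn => lt_of_le_of_lt ?_ (half_lt_self hε)⟩
      rw [ContinuousMap.dist_le (by positivity)]
      intro t
      have h1 := hK _ _ _ _ (hu m) (hu n) (hM _ (hs m).2 _ (hu m)) (hM _ (hs n).2 _ (hu n)) t t.2
      rw [← sub_smul, norm_smul] at h1
      have h2 := (hn₀ m hm n hn).le
      rw [Real.dist_eq, ← mul_sub, abs_mul] at h2
      rw [dist_eq_norm]
      refine h1.trans (le_trans ?_ h2)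
      calc K * (‖s m - s n‖ * ‖u₀‖) = K * ‖u₀‖ * |s m - s n| := by
            rw [Real.norm_eq_abs]; ring
        _ ≤ _ := mul_le_mul_of_nonneg_right (le_abs_self _) (abs_nonneg _)
    obtain ⟨g, hg⟩ := cauchySeq_tendsto_of_complete hcauchy
    exact ⟨⟨_, isMild_of_tendsto hU hF hT hfm (ha.smul_const u₀) hg⟩, ha01⟩
  have hzero : (0 : ℝ) ∈ A := ⟨fun _ => 0, continuous_const, fun t _ => by simp [hF.map_zero]⟩
  have hopen : ∀ s ∈ A ∩ Ico 0 1, A ∈ 𝓝[>] s := by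
    rintro s ⟨⟨u, hu⟩, -⟩
    obtain ⟨g, -, hg⟩ := hu.exists_contDiffAt_family hU hF hT
    have hc : Continuous fun r : ℝ => r • u₀ := by fun_prop
    refine nhdsWithin_le_nhds ?_
    filter_upwards [(hc.tendsto s).eventually hg] with r hr
    exact ⟨_, hr⟩
  obtain ⟨u, hu⟩ := hclosed.Icc_subset_of_forall_mem_nhdsWithin hzero hopen
    (right_mem_Icc.2 zero_le_one)
  exact ⟨u, by simpa using hu⟩

/-- A priori bounds yield a global flow that depends smoothly on the initial value. -/
theorem exists_smooth_flow (hU : IsBoundedGroup U) (hF : IsSmoothNonlinearity F) {D : Set V}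
    (hD : IsOpen D) (hbound : ∀ u₀ ∈ D, ∀ T > 0, ∃ M : ℝ, ∀ s ∈ Icc (0 : ℝ) 1,
      ∀ u, IsMild U F T (s • u₀) u → ∀ t ∈ Icc (-T) T, ‖u t‖ ≤ M) :
    ∃ S : V → C(ℝ, V), (∀ u₀ ∈ D, ∀ T > 0, IsMild U F T u₀ (S u₀)) ∧
      ∀ T > 0, ContDiffOn ℝ ∞ (fun u₀ => (S u₀).restrict (Icc (-T) T)) D := by
  have hex : ∀ u₀ ∈ D, ∃ S : C(ℝ, V), ∀ T > 0, IsMild U F T u₀ S := by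
    intro u₀ hu₀
    have h : ∀ T : ℝ, 0 < T → ∃ u, IsMild U F T u₀ u := fun T hT => by
      obtain ⟨M, hM⟩ := hbound u₀ hu₀ T hT
      exact exists_isMild_of_bound hU hF hT hM
    choose! u hu using h
    set v : ℝ → V := fun t => u (|t| + 1) t with hv
    have hvu : ∀ T, 0 < T → EqOn v (u T) (Icc (-T) T) := fun T hT t ht => by
      have htT : |t| ≤ T := abs_le.2 ht
      rcases le_total (|t| + 1) T with h | h
      · exact (hu (|t| + 1) (by positivity)).unique hU hF ((hu T hT).mono h)
          (abs_le.1 (by linarith))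
      · exact ((hu (|t| + 1) (by positivity)).mono h).unique hU hF (hu T hT) ht
    have hvc : Continuous v := by
      rw [continuous_iff_continuousAt]
      intro t
      have hT : 0 < |t| + 1 := by positivity
      refine ((hu _ hT).1.continuousAt (x := t)).congr ?_
      have ht : t ∈ Ioo (-(|t| + 1)) (|t| + 1) := abs_lt.1 (by linarith)
      filter_upwards [Ioo_mem_nhds ht.1 ht.2] with r hr
      exact (hvu _ hT (Ioo_subset_Icc_self hr)).symm
    refine ⟨⟨v, hvc⟩, fun T hT => ⟨hvc, fun t ht => ?_⟩⟩
    have h0 : (0 : ℝ) ∈ Icc (-T) T := ⟨by linarith, hT.le⟩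
    simp only [ContinuousMap.coe_mk]
    rw [hvu T hT ht, (hu T hT).2 t ht]
    congr 2
    refine intervalIntegral.integral_congr fun r hr => ?_
    rw [hvu T hT (uIcc_subset_Icc h0 ht hr)]
  choose! S hS using hex
  refine ⟨S, hS, fun T hT u₀ hu₀ => ContDiffAt.contDiffWithinAt ?_⟩
  obtain ⟨g, hg, hgm⟩ := (hS u₀ hu₀ T hT).exists_contDiffAt_family hU hF hT
  refine hg.congr_of_eventuallyEq ?_
  filter_upwards [hgm, hD.mem_nhds hu₀] with v hv hvD
  ext t
  have := (hS v hvD T hT).unique hU hF hv t.2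
  rw [IccExtend_val] at this
  exact this

end Duhamel

/-! ### Polynomial nonlinearities are smooth -/

section Polynomial

variable {V : Type*} [NormedAddCommGroup V] [NormedSpace ℝ V]

theorem isSmoothNonlinearity_id : IsSmoothNonlinearity fun x : V => x where
  map_zero := rfl
  continuous := continuous_id
  lipschitz _ := ⟨1, zero_le_one, fun x y _ _ => by rw [one_mul]⟩
  contDiff_comp _ := contDiff_id

theorem IsSmoothNonlinearity.linear_comp (A : V →L[ℝ] V) {F : V → V}
    (hF : IsSmoothNonlinearity F) : IsSmoothNonlinearity fun x => A (F x) where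
  map_zero := by rw [hF.map_zero, _root_.map_zero]
  continuous := A.continuous.comp hF.continuous
  lipschitz M := by
    obtain ⟨L, hL0, hL⟩ := hF.lipschitz M
    refine ⟨‖A‖ * L, by positivity, fun x y hx hy => ?_⟩
    rw [← map_sub, mul_assoc]
    exact (A.le_opNorm _).trans (mul_le_mul_of_nonneg_left (hL x y hx hy) (norm_nonneg _))
  contDiff_comp T :=
    (A.compLeftContinuous ℝ (Icc (-T) T)).contDiff.comp (hF.contDiff_comp T)

theorem IsSmoothNonlinearity.add {F G : V → V} (hF : IsSmoothNonlinearity F)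
    (hG : IsSmoothNonlinearity G) : IsSmoothNonlinearity fun x => F x + G x where
  map_zero := by simp [hF.map_zero, hG.map_zero]
  continuous := hF.continuous.add hG.continuous
  lipschitz M := by
    obtain ⟨L, hL0, hL⟩ := hF.lipschitz M
    obtain ⟨L', hL'0, hL'⟩ := hG.lipschitz M
    refine ⟨L + L', by positivity, fun x y hx hy => ?_⟩
    calc ‖F x + G x - (F y + G y)‖ = ‖(F x - F y) + (G x - G y)‖ := by congr 1; abel
      _ ≤ ‖F x - F y‖ + ‖G x - G y‖ := norm_add_le _ _
      _ ≤ L * ‖x - y‖ + L' * ‖x - y‖ := add_le_add (hL x y hx hy) (hL' x y hx hy)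
      _ = _ := by ring
  contDiff_comp T := (hF.contDiff_comp T).add (hG.contDiff_comp T)

theorem IsSmoothNonlinearity.bilinear (B : V →L[ℝ] V →L[ℝ] V) {F G : V → V}
    (hF : IsSmoothNonlinearity F) (hG : IsSmoothNonlinearity G) :
    IsSmoothNonlinearity fun x => B (F x) (G x) where
  map_zero := by simp [hF.map_zero]
  continuous := (B.continuous.comp hF.continuous).clm_apply hG.continuous
  lipschitz M := by
    obtain ⟨L, hL0, hL⟩ := hF.lipschitz M
    obtain ⟨L', hL'0, hL'⟩ := hG.lipschitz M
    refine ⟨‖B‖ * L * (L' * |M|) + ‖B‖ * (L * |M|) * L', by positivity, fun x y hx hy => ?_⟩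
    have hM : ‖(0 : V)‖ ≤ M := by rw [norm_zero]; exact (norm_nonneg x).trans hx
    have hGx : ‖G x‖ ≤ L' * |M| := by
      have := hL' x 0 hx hM
      rw [hG.map_zero, sub_zero, sub_zero] at this
      exact this.trans (mul_le_mul_of_nonneg_left (hx.trans (le_abs_self M)) hL'0)
    have hFy : ‖F y‖ ≤ L * |M| := by
      have := hL y 0 hy hM
      rw [hF.map_zero, sub_zero, sub_zero] at this
      exact this.trans (mul_le_mul_of_nonneg_left (hy.trans (le_abs_self M)) hL0)
    calc ‖B (F x) (G x) - B (F y) (G y)‖ = ‖B (F x - F y) (G x) + B (F y) (G x - G y)‖ := by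
          congr 1
          rw [map_sub, map_sub, sub_apply]
          abel
      _ ≤ ‖B (F x - F y) (G x)‖ + ‖B (F y) (G x - G y)‖ := norm_add_le _ _
      _ ≤ ‖B‖ * ‖F x - F y‖ * ‖G x‖ + ‖B‖ * ‖F y‖ * ‖G x - G y‖ :=
          add_le_add (B.le_opNorm₂ _ _) (B.le_opNorm₂ _ _)
      _ ≤ ‖B‖ * (L * ‖x - y‖) * (L' * |M|) + ‖B‖ * (L * |M|) * (L' * ‖x - y‖) := by
          have := hL x y hx hy
          have := hL' x y hx hy
          gcongr
      _ = _ := by ring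
  contDiff_comp T := by
    -- the bilinear map acts pointwise on `C([-T, T]; V)` and is bounded there
    let B' : C(Icc (-T) T, V) →L[ℝ] C(Icc (-T) T, V) →L[ℝ] C(Icc (-T) T, V) :=
      LinearMap.mkContinuous₂ (LinearMap.mk₂ ℝ
        (fun f g => ⟨fun t => B (f t) (g t),
          (B.continuous.comp f.continuous).clm_apply g.continuous⟩)
        (fun f g h => by ext t; simp) (fun c f g => by ext t; simp)
        (fun f g h => by ext t; simp) (fun c f g => by ext t; simp)) ‖B‖ fun f g =>
        (ContinuousMap.norm_le _ (by positivity)).2 fun t =>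
          (B.le_opNorm₂ _ _).trans (by
            have := f.norm_coe_le_norm t
            have := g.norm_coe_le_norm t
            gcongr)
    exact (B'.contDiff.comp (hF.contDiff_comp T)).clm_apply (hG.contDiff_comp T)

end Polynomial

namespace H1

/-- The map `u ↦ |u|²` on `H¹(ℝ)`. -/
def modSq (u : H1) : H1 := mul u (conjL u)

theorem rep_modSq (u : H1) (x : ℝ) : rep (modSq u) x = (‖rep u x‖ : ℂ) ^ 2 := by
  rw [modSq, rep_mul, rep_conjL, Complex.mul_conj']

/-- The cubic-quintic nonlinearity as a map of `H¹(ℝ)` into itself. -/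
def nonlinH1 (l₁ l₂ : ℝ) (u : H1) : H1 :=
  l₁ • mul (modSq u) u + l₂ • mul (modSq u) (mul (modSq u) u)

theorem rep_nonlinH1 (l₁ l₂ : ℝ) (u : H1) (x : ℝ) :
    rep (nonlinH1 l₁ l₂ u) x = nonlin l₁ l₂ (rep u x) := by
  simp only [nonlinH1, nonlin, rep_add, rep_real_smul, rep_mul, rep_modSq]
  push_cast
  ring

/-- The forcing `i (F(u) + m u)` of the evolution equation with the coercive form `A_Z + m`. -/
def forcing (Z l₁ l₂ : ℝ) (u : H1) : H1 := Complex.I • (nonlinH1 l₁ l₂ u + shift Z • u)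

theorem isSmoothNonlinearity_nonlinH1 (l₁ l₂ : ℝ) : IsSmoothNonlinearity (nonlinH1 l₁ l₂) := by
  have h1 : IsSmoothNonlinearity modSq :=
    .bilinear mul isSmoothNonlinearity_id (isSmoothNonlinearity_id.linear_comp conjL)
  have h2 : IsSmoothNonlinearity fun u => mul (modSq u) u :=
    .bilinear mul h1 isSmoothNonlinearity_id
  have h3 : IsSmoothNonlinearity fun u => mul (modSq u) (mul (modSq u) u) := .bilinear mul h1 h2
  have h4 : IsSmoothNonlinearity fun u => (l₁ • ContinuousLinearMap.id ℝ H1) (mul (modSq u) u) :=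
    h2.linear_comp _
  have h5 : IsSmoothNonlinearity fun u =>
      (l₂ • ContinuousLinearMap.id ℝ H1) (mul (modSq u) (mul (modSq u) u)) := h3.linear_comp _
  exact h4.add h5

theorem isSmoothNonlinearity_forcing (Z l₁ l₂ : ℝ) : IsSmoothNonlinearity (forcing Z l₁ l₂) := by
  have h1 : IsSmoothNonlinearity fun u : H1 => (shift Z • ContinuousLinearMap.id ℝ H1) u :=
    isSmoothNonlinearity_id.linear_comp _
  have h2 := (isSmoothNonlinearity_nonlinH1 l₁ l₂).add h1
  have h3 := h2.linear_comp ((Complex.I • ContinuousLinearMap.id ℂ H1).restrictScalars ℝ)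
  exact h3

end H1

open H1

/-! ### The equation as an evolution equation in `H⁻¹(ℝ)` -/

/-- The group `e^{-it(A_Z + m)}` on `H¹(ℝ)`, characterised by its bounded properties: it preserves
the coercive form `A_Z + m` and solves `i u' = (A_Z + m) u` in `H⁻¹(ℝ)`. -/
structure IsFormGroup (Z : ℝ) (U : ℝ → H1 →L[ℂ] H1) : Prop where
  map_zero : U 0 = 1
  map_add : ∀ t s, U (t + s) = U t * U s
  inner_gramForm : ∀ t x y, inner ℂ (U t x) (gramForm Z (U t y)) = inner ℂ x (gramForm Z y)
  continuous_apply : ∀ x, Continuous fun t => U t x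
  hasDerivAt_gramL2 : ∀ t x,
    HasDerivAt (fun s => gramL2 (U s x)) (-Complex.I • gramForm Z (U t x)) t

theorem exists_isFormGroup (Z : ℝ) : ∃ U, IsFormGroup Z U := by
  obtain ⟨U, h0, h1, h2, h3, h4⟩ := exists_form_group (isSelfAdjoint_gramForm Z) one_half_pos
    (gramForm_coercive Z) isSelfAdjoint_gramL2 gramL2_injective
  exact ⟨U, h0, h1, h2, h3, h4⟩

theorem IsFormGroup.isBoundedGroup {Z : ℝ} {U : ℝ → H1 →L[ℂ] H1} (hU : IsFormGroup Z U) :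
    IsBoundedGroup fun t => (U t).restrictScalars ℝ where
  map_zero := by ext1 x; simp [hU.map_zero]
  map_add t s := by ext1 x; simp [hU.map_add]
  continuous_apply x := hU.continuous_apply x
  exists_bound := by
    refine ⟨Real.sqrt (2 * ‖gramForm Z‖), Real.sqrt_nonneg _, fun t x => ?_⟩
    have h1 := gramForm_coercive Z (U t x)
    rw [hU.inner_gramForm] at h1
    have h2 : (inner ℂ x (gramForm Z x)).re ≤ ‖x‖ * (‖gramForm Z‖ * ‖x‖) :=
      (Complex.re_le_norm _).trans ((norm_inner_le_norm _ _).trans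
        (mul_le_mul_of_nonneg_left (ContinuousLinearMap.le_opNorm _ _) (norm_nonneg _)))
    refine (pow_le_pow_iff_left₀ (norm_nonneg _) (by positivity) two_ne_zero).1 ?_
    rw [mul_pow, Real.sq_sqrt (by positivity)]
    change ‖U t x‖ ^ 2 ≤ _
    nlinarith

/-- The right-hand side of the equation solved for `u_t`: the functional
`v ↦ -i ⟨A_Z u, v⟩ + i ⟨F(u), v⟩`. -/
def velocity (Z l₁ l₂ : ℝ) (u : H1) : Hneg1 :=
  innerSLFlip ℂ (gramL2 (forcing Z l₁ l₂ u) - Complex.I • gramForm Z u)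

variable {Z l₁ l₂ T : ℝ}

theorem velocity_apply (u v : H1) : velocity Z l₁ l₂ u v
    = Complex.I * (inner ℂ (toL2 v) (toL2 (nonlinH1 l₁ l₂ u))
      + shift Z * inner ℂ (toL2 v) (toL2 u) - inner ℂ v (gramForm Z u)) := by
  rw [velocity, innerSLFlip_apply_apply, inner_sub_right, inner_smul_right, inner_gramL2, forcing,
    map_smul, map_add, inner_smul_right, inner_add_right, ← Complex.coe_smul (shift Z) u, map_smul,
    inner_smul_right]
  ring

theorem continuous_velocity : Continuous (velocity Z l₁ l₂) :=
  (innerSLFlip ℂ).continuous.comp ((gramL2.continuous.comp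
    (isSmoothNonlinearity_forcing Z l₁ l₂).continuous).sub (Complex.I • gramForm Z).continuous)

/-- A solution is a continuous curve in `H¹(ℝ)` whose derivative in `H⁻¹(ℝ)` is the velocity. -/
theorem isSolution_iff {J : Set ℝ} {u : ℝ → H1} : IsSolution Z l₁ l₂ J u ↔ ContinuousOn u J ∧
    ∀ t ∈ J, HasDerivWithinAt (fun s => toHneg1 (u s)) (velocity Z l₁ l₂ (u t)) J t := by
  have hint : ∀ w v : H1, ∫ x, nonlin l₁ l₂ (rep w x) * conj (rep v x)
      = inner ℂ (toL2 v) (toL2 (nonlinH1 l₁ l₂ w)) := fun w v => by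
    rw [inner_toL2]; simp only [rep_nonlinH1]
  have heq : ∀ (w v : H1) (q : ℂ), Complex.I * q - formA Z w v
      + ∫ x, nonlin l₁ l₂ (rep w x) * conj (rep v x) = 0 ↔ q = velocity Z l₁ l₂ w v := by
    intro w v q
    rw [hint, formA_eq, inner_gramL2, velocity_apply]
    constructor
    · intro h
      have := congrArg (fun z => -Complex.I * z) h
      linear_combination this + q * Complex.I_sq
    · rintro rfl
      linear_combination (inner ℂ (toL2 v) (toL2 (nonlinH1 l₁ l₂ w))
        + shift Z * inner ℂ (toL2 v) (toL2 w) - inner ℂ v (gramForm Z w)) * Complex.I_sq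
  constructor
  · rintro ⟨hc, u', -, h⟩
    refine ⟨hc, fun t ht => ?_⟩
    have : u' t = velocity Z l₁ l₂ (u t) := by
      ext v
      exact (heq _ _ _).1 ((h t ht).2 v)
    rw [← this]
    exact (h t ht).1
  · rintro ⟨hc, h⟩
    exact ⟨hc, fun t => velocity Z l₁ l₂ (u t), continuous_velocity.comp_continuousOn hc,
      fun t ht => ⟨h t ht, fun v => (heq _ _ _).2 rfl⟩⟩

section Mild

variable {U : ℝ → H1 →L[ℂ] H1} {u₀ : H1} {u : ℝ → H1}

theorem IsMild.hasDerivWithinAt (hU : IsFormGroup Z U)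
    (hu : IsMild (fun t => (U t).restrictScalars ℝ) (forcing Z l₁ l₂) T u₀ u) {t : ℝ}
    (ht : t ∈ Icc (-T) T) :
    HasDerivWithinAt (fun s => toHneg1 (u s)) (velocity Z l₁ l₂ (u t)) (Icc (-T) T) t := by
  have hB := hU.isBoundedGroup
  set v : ℝ → H1 := fun t => u₀ + ∫ s in (0 : ℝ)..t, (U (-s)) (forcing Z l₁ l₂ (u s)) with hv
  have hvd : HasDerivAt v (U (-t) (forcing Z l₁ l₂ (u t))) t :=
    hasDerivAt_interaction hB (isSmoothNonlinearity_forcing Z l₁ l₂).continuous hu.1 u₀ t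
  have huv : ∀ s ∈ Icc (-T) T, u s = U s (v s) := fun s hs => hu.2 s hs
  have h1 : HasDerivAt (fun s => U s (v s - v t)) (forcing Z l₁ l₂ (u t)) t := by
    have := hB.hasDerivAt_apply_of_eq_zero (hvd.sub_const (v t)) (sub_self _)
    have e : U t (U (-t) (forcing Z l₁ l₂ (u t))) = forcing Z l₁ l₂ (u t) := hB.apply_neg t _
    simpa [e] using this
  have h2 := ((gramL2.restrictScalars ℝ).hasFDerivAt.comp_hasDerivAt t h1).add
    (hU.hasDerivAt_gramL2 t (v t))
  have h3 : HasDerivAt (fun s => gramL2 (U s (v s)))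
      (gramL2 (forcing Z l₁ l₂ (u t)) - Complex.I • gramForm Z (u t)) t := by
    convert h2 using 1
    · funext s
      simp [Function.comp_def]
    · rw [huv t ht, neg_smul, ← sub_eq_add_neg]
      rfl
  have h4 := ((innerSLFlip ℂ : H1 →L[ℂ] Hneg1).restrictScalars ℝ).hasFDerivAt.comp_hasDerivAt t h3
  have hJ : ∀ w : H1, toHneg1 w = innerSLFlip ℂ (gramL2 w) := fun w => by
    ext x
    rw [toHneg1_apply, innerSLFlip_apply_apply]
  refine (h4.hasDerivWithinAt (s := Icc (-T) T)).congr (fun s hs => ?_) ?_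
  · rw [hJ, huv s hs]; rfl
  · rw [hJ, huv t ht]; rfl

theorem IsMild.isSolution_Icc (hU : IsFormGroup Z U)
    (hu : IsMild (fun t => (U t).restrictScalars ℝ) (forcing Z l₁ l₂) T u₀ u) :
    IsSolution Z l₁ l₂ (Icc (-T) T) u :=
  isSolution_iff.2 ⟨hu.1.continuousOn, fun _ ht => hu.hasDerivWithinAt hU ht⟩

theorem isSolution_univ_of_isMild (hU : IsFormGroup Z U)
    (hu : ∀ T > 0, IsMild (fun t => (U t).restrictScalars ℝ) (forcing Z l₁ l₂) T u₀ u) :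
    IsSolution Z l₁ l₂ univ u := by
  refine isSolution_iff.2 ⟨(hu 1 one_pos).1.continuousOn, fun t _ => ?_⟩
  have hT : 0 < |t| + 1 := by positivity
  have ht : t ∈ Ioo (-(|t| + 1)) (|t| + 1) := abs_lt.1 (by linarith)
  exact (((hu _ hT).hasDerivWithinAt hU (Ioo_subset_Icc_self ht)).hasDerivAt
    (Icc_mem_nhds ht.1 ht.2)).hasDerivWithinAt

end Mild

/-! ### Functionals along curves that are differentiable in `H⁻¹(ℝ)` -/

theorem tendsto_dual_apply {X : Type*} {l : Filter X} {f : X → Hneg1} {g : X → H1} {φ : Hneg1}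
    {x : H1} (hf : Tendsto f l (𝓝 φ)) (hg : Tendsto g l (𝓝 x)) :
    Tendsto (fun y => f y (g y)) l (𝓝 (φ x)) := by
  have h1 : Tendsto (fun y => (f y - φ) (g y)) l (𝓝 0) := by
    refine squeeze_zero_norm (fun y => (f y - φ).le_opNorm _) ?_
    simpa using ((hf.sub_const φ).norm).mul hg.norm
  simpa using h1.add ((φ.continuous.tendsto x).comp hg)

/-- If the functional `P` on `H¹(ℝ)` has a continuous `L²` gradient with values in `H¹(ℝ)`, then it
satisfies the chain rule along curves that are continuous in `H¹(ℝ)` but differentiable only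
in `H⁻¹(ℝ)`. -/
theorem hasDerivWithinAt_of_gradient {P : H1 → ℝ} {grad : H1 → H1} (hg : Continuous grad)
    (hP : ∀ u w : H1, HasDerivAt (fun s : ℝ => P (u + s • w)) (toHneg1 w (grad u)).re 0)
    {J : Set ℝ} {u : ℝ → H1} {u' : Hneg1} {t : ℝ} (hu : ContinuousWithinAt u J t)
    (hu' : HasDerivWithinAt (fun s => toHneg1 (u s)) u' J t) :
    HasDerivWithinAt (fun s => P (u s)) (u' (grad (u t))).re J t := by
  -- mean value theorem on the segment from `u t` to `u s`
  have hmean : ∀ s, ∃ c : H1, ‖c - u t‖ ≤ ‖u s - u t‖ ∧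
      P (u s) - P (u t) = (toHneg1 (u s - u t) (grad c)).re := by
    intro s
    set w := u s - u t with hw
    have hline : ∀ r : ℝ, HasDerivAt (fun r : ℝ => P (u t + r • w))
        (toHneg1 w (grad (u t + r • w))).re r := fun r => by
      have h := (hP (u t + r • w) w)
      have h' : HasDerivAt (fun x : ℝ => x - r) 1 r := (hasDerivAt_id r).sub_const r
      have h2 := h.scomp_of_eq r h' (sub_self r).symm
      simp only [one_smul, Function.comp_def] at h2
      refine h2.congr_of_eventuallyEq (Eventually.of_forall fun x => ?_)
      simp only
      congr 1
      rw [add_assoc, ← add_smul]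
      congr 2
      ring
    obtain ⟨θ, hθ, h⟩ := exists_hasDerivAt_eq_slope (fun r : ℝ => P (u t + r • w)) _ zero_lt_one
      (fun r _ => (hline r).continuousAt.continuousWithinAt) (fun r _ => hline r)
    refine ⟨u t + θ • w, ?_, ?_⟩
    · rw [add_sub_cancel_left, norm_smul, Real.norm_of_nonneg hθ.1.le]
      exact mul_le_of_le_one_left (norm_nonneg _) hθ.2.le
    · rw [h]
      simp [hw]
  choose c hc hPc using hmean
  have hct : Tendsto c (𝓝[J \ {t}] t) (𝓝 (u t)) := by
    rw [tendsto_iff_norm_sub_tendsto_zero]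
    refine squeeze_zero (fun _ => norm_nonneg _) hc ?_
    have := (hu.mono sdiff_subset : ContinuousWithinAt u (J \ {t}) t).tendsto
    rwa [tendsto_iff_norm_sub_tendsto_zero] at this
  rw [hasDerivWithinAt_iff_tendsto_slope] at hu' ⊢
  have hgc : Tendsto (fun s => grad (c s)) (𝓝[J \ {t}] t) (𝓝 (grad (u t))) :=
    (hg.tendsto _).comp hct
  have hpair : Tendsto (fun s => (slope (fun s => toHneg1 (u s)) t s) (grad (c s)))
      (𝓝[J \ {t}] t) (𝓝 (u' (grad (u t)))) := tendsto_dual_apply hu' hgc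
  refine ((Complex.continuous_re.tendsto _).comp hpair).congr fun s => ?_
  have hsub : toHneg1 (u s - u t) = toHneg1 (u s) - toHneg1 (u t) := by
    ext v
    simp only [toHneg1_apply, map_sub, inner_sub_right, sub_apply]
  simp only [Function.comp_apply, slope_def_module, hPc, hsub, smul_apply,
    smul_eq_mul, Complex.smul_re]

theorem hasDerivAt_norm_toL2_sq {f : ℝ → H1} {f' : H1} {s : ℝ} (hf : HasDerivAt f f' s) :
    HasDerivAt (fun s => ‖toL2 (f s)‖ ^ 2) (2 * (inner ℂ (toL2 (f s)) (toL2 f')).re) s := by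
  have h1 := (toL2.restrictScalars ℝ).hasFDerivAt.comp_hasDerivAt s hf
  have h2 := Complex.reCLM.hasFDerivAt.comp_hasDerivAt s (h1.inner ℂ h1)
  have e : (fun s => ‖toL2 (f s)‖ ^ 2)
      = Complex.reCLM ∘ fun s => inner ℂ (toL2 (f s)) (toL2 (f s)) := by
    funext s
    exact (inner_self_eq_norm_sq (𝕜 := ℂ) (toL2 (f s))).symm
  rw [e]
  refine HasDerivAt.congr_deriv h2 ?_
  have : (inner ℂ (toL2 f') (toL2 (f s))).re = (inner ℂ (toL2 (f s)) (toL2 f')).re :=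
    inner_re_symm (𝕜 := ℂ) _ _
  refine Eq.trans (b := (inner ℂ (toL2 (f s)) (toL2 f')).re + (inner ℂ (toL2 f') (toL2 (f s))).re)
    rfl ?_
  rw [this, two_mul]

theorem hasDerivAt_line (u w : H1) : HasDerivAt (fun s : ℝ => u + s • w) w 0 := by
  simpa using ((hasDerivAt_id (0 : ℝ)).smul_const w).const_add u

theorem hasDerivAt_mass (u w : H1) : HasDerivAt (fun s : ℝ => ‖toL2 (u + s • w)‖ ^ 2)
    (toHneg1 w ((2 : ℂ) • u)).re 0 := by
  have h := hasDerivAt_norm_toL2_sq (hasDerivAt_line u w)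
  rw [toHneg1_apply, inner_smul_left, inner_gramL2]
  simpa using h

/-- The potential energy `∫ (λ₁/4 |u|⁴ + λ₂/6 |u|⁶)`. -/
def potential (l₁ l₂ : ℝ) (u : H1) : ℝ :=
  l₁ / 4 * ‖toL2 (modSq u)‖ ^ 2 + l₂ / 6 * ‖toL2 (mul (modSq u) u)‖ ^ 2

theorem re_inner_toL2 (u v : H1) : (inner ℂ (toL2 u) (toL2 v)).re
    = ∫ x, (rep v x * conj (rep u x)).re := by
  rw [inner_toL2]
  exact (integral_re (integrable_rep_mul_conj u v)).symm

theorem hasDerivAt_potential (u w : H1) : HasDerivAt (fun s : ℝ => potential l₁ l₂ (u + s • w))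
    (toHneg1 w (nonlinH1 l₁ l₂ u)).re 0 := by
  have h1 := hasDerivAt_line u w
  have h2 := mul.hasDerivAt_of_bilinear (fun _ => h1) (fun _ =>
    conjL.hasFDerivAt.comp_hasDerivAt (0 : ℝ) h1)
  have h3 := mul.hasDerivAt_of_bilinear (fun _ => h2) (fun _ => h1)
  have h := ((hasDerivAt_norm_toL2_sq h2).const_mul (l₁ / 4)).add
    ((hasDerivAt_norm_toL2_sq h3).const_mul (l₂ / 6))
  refine HasDerivAt.congr_deriv h ?_
  simp only [Function.comp_apply, zero_smul, add_zero]
  rw [toHneg1_apply, inner_gramL2, re_inner_toL2, re_inner_toL2, re_inner_toL2]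
  have hi : ∀ a b : H1, Integrable fun x => (rep b x * conj (rep a x)).re := fun a b =>
    (integrable_rep_mul_conj a b).re
  rw [← integral_const_mul, ← integral_const_mul, ← integral_const_mul, ← integral_const_mul,
    ← integral_add (((hi _ _).const_mul _).const_mul _) (((hi _ _).const_mul _).const_mul _)]
  refine integral_congr_ae (Eventually.of_forall fun x => ?_)
  simp only [rep_nonlinH1, nonlin, rep_add, rep_mul, rep_conjL, map_add, add_apply, map_mul,
    Complex.conj_conj, Complex.conj_ofReal]
  have hn : ‖rep u x‖ ^ 2 = (rep u x).re ^ 2 + (rep u x).im ^ 2 := by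
    rw [← Complex.normSq_eq_norm_sq, Complex.normSq_apply]; ring
  have hn4 : ‖rep u x‖ ^ 4 = ((rep u x).re ^ 2 + (rep u x).im ^ 2) ^ 2 := by
    rw [← hn]; ring
  rw [hn, hn4]
  simp only [Complex.mul_re, Complex.mul_im, Complex.add_re, Complex.add_im, Complex.conj_re,
    Complex.conj_im, Complex.ofReal_re, Complex.ofReal_im]
  ring

/-! ### Uniqueness and conservation of mass -/

theorem exists_lipschitz_nonlin (l₁ l₂ M : ℝ) : ∃ L : ℝ, 0 ≤ L ∧ ∀ z w : ℂ, ‖z‖ ≤ M → ‖w‖ ≤ M →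
    ‖nonlin l₁ l₂ z - nonlin l₁ l₂ w‖ ≤ L * ‖z - w‖ := by
  have hc : ContDiff ℝ 1 (nonlin l₁ l₂) := by
    have e : nonlin l₁ l₂ = fun z => (l₁ * ‖z‖ ^ 2 + l₂ * (‖z‖ ^ 2) ^ 2) • z := by
      funext z
      rw [nonlin, Complex.real_smul, ← pow_mul]
    rw [e]
    have h2 : ContDiff ℝ 1 fun z : ℂ => ‖z‖ ^ 2 := contDiff_norm_sq ℝ
    exact ((contDiff_const.mul h2).add (contDiff_const.mul (h2.pow 2))).smul contDiff_id
  obtain ⟨K, hK⟩ := hc.contDiffOn.exists_lipschitzOnWith one_ne_zero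
    (convex_closedBall (0 : ℂ) M) (isCompact_closedBall 0 M)
  refine ⟨K, K.2, fun z w hz hw => ?_⟩
  exact hK.norm_sub_le (mem_closedBall_zero_iff.2 hz) (mem_closedBall_zero_iff.2 hw)

theorem im_inner_gramForm_self (u : H1) : (inner ℂ u (gramForm Z u)).im = 0 := by
  rw [← Complex.conj_eq_iff_im, inner_conj_symm]
  exact ((isSelfAdjoint_gramForm Z).isSymmetric u u)

theorem im_inner_nonlinH1 (u : H1) : (inner ℂ (toL2 u) (toL2 (nonlinH1 l₁ l₂ u))).im = 0 := by
  rw [inner_toL2]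
  refine (integral_im (𝕜 := ℂ) (integrable_rep_mul_conj u _)).symm.trans ?_
  refine integral_eq_zero_of_ae (Eventually.of_forall fun x => ?_)
  simp only [rep_nonlinH1, nonlin, mul_assoc, Complex.mul_conj']
  rw [← Complex.ofReal_pow, ← Complex.ofReal_mul]
  exact Complex.ofReal_im ((l₁ * ‖rep u x‖ ^ 2 + l₂ * ‖rep u x‖ ^ 4) * ‖rep u x‖ ^ 2)

/-- The `L²` distance of two solutions evolves by the nonlinear part of the equation only, since
`A_Z` is symmetric. -/
theorem re_velocity_sub (u w : H1) :
    ((velocity Z l₁ l₂ u - velocity Z l₁ l₂ w) ((2 : ℂ) • (u - w))).re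
      = -2 * (inner ℂ (toL2 (u - w)) (toL2 (nonlinH1 l₁ l₂ u - nonlinH1 l₁ l₂ w))).im := by
  have h1 := im_inner_gramForm_self (Z := Z) (u - w)
  have h2 : (inner ℂ (toL2 (u - w)) (toL2 (u - w))).im = 0 := inner_self_im (𝕜 := ℂ) _
  have e : (velocity Z l₁ l₂ u - velocity Z l₁ l₂ w) ((2 : ℂ) • (u - w))
      = 2 * (Complex.I * (inner ℂ (toL2 (u - w)) (toL2 (nonlinH1 l₁ l₂ u - nonlinH1 l₁ l₂ w))
        + shift Z * inner ℂ (toL2 (u - w)) (toL2 (u - w))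
        - inner ℂ (u - w) (gramForm Z (u - w)))) := by
    simp only [sub_apply, velocity_apply, map_smul, inner_smul_left, map_sub, inner_sub_right,
      Complex.conj_ofNat]
    ring
  rw [e]
  simp only [Complex.mul_re, Complex.mul_im, Complex.add_im, Complex.sub_im, Complex.I_re,
    Complex.I_im, h1, h2, Complex.ofReal_im, Complex.ofReal_re, Complex.re_ofNat,
    Complex.im_ofNat]
  ring

theorem hasDerivWithinAt_norm_toL2_sub_sq {J : Set ℝ} {u w : ℝ → H1}
    (hu : IsSolution Z l₁ l₂ J u) (hw : IsSolution Z l₁ l₂ J w) {t : ℝ} (ht : t ∈ J) :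
    HasDerivWithinAt (fun s => ‖toL2 (u s - w s)‖ ^ 2)
      (-2 * (inner ℂ (toL2 (u t - w t))
        (toL2 (nonlinH1 l₁ l₂ (u t) - nonlinH1 l₁ l₂ (w t)))).im) J t := by
  rw [isSolution_iff] at hu hw
  have hd : HasDerivWithinAt (fun s => toHneg1 (u s - w s))
      (velocity Z l₁ l₂ (u t) - velocity Z l₁ l₂ (w t)) J t := by
    have h := (hu.2 t ht).sub (hw.2 t ht)
    have e : (fun s => toHneg1 (u s - w s))
        = (fun s => toHneg1 (u s)) - fun s => toHneg1 (w s) := by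
      funext s
      ext v
      simp only [toHneg1_apply, map_sub, inner_sub_right, sub_apply, Pi.sub_apply]
    rwa [e]
  rw [← re_velocity_sub]
  exact hasDerivWithinAt_of_gradient (P := fun u => ‖toL2 u‖ ^ 2) (continuous_const_smul (2 : ℂ))
    hasDerivAt_mass ((hu.1 t ht).sub (hw.1 t ht)) hd

/-- Unconditional uniqueness: an `L²` energy estimate for the difference suffices because
`H¹(ℝ) ⊂ L^∞(ℝ)`. -/
theorem IsSolution.eqOn {u w : ℝ → H1} (hu : IsSolution Z l₁ l₂ (Icc (-T) T) u)
    (hw : IsSolution Z l₁ l₂ (Icc (-T) T) w) (h0 : u 0 = w 0) : EqOn u w (Icc (-T) T) := by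
  obtain ⟨M, hM⟩ := isCompact_Icc.exists_bound_of_continuousOn hu.1
  obtain ⟨M', hM'⟩ := isCompact_Icc.exists_bound_of_continuousOn hw.1
  obtain ⟨L, hL0, hL⟩ := exists_lipschitz_nonlin l₁ l₂ (max M M')
  have hn : ∀ t ∈ Icc (-T) T, ‖toL2 (nonlinH1 l₁ l₂ (u t) - nonlinH1 l₁ l₂ (w t))‖
      ≤ L * ‖toL2 (u t - w t)‖ := fun t ht => norm_toL2_le_mul fun x => by
    rw [rep_sub, rep_sub, rep_nonlinH1, rep_nonlinH1]
    exact hL _ _ ((norm_rep_le _ _).trans ((hM t ht).trans (le_max_left _ _)))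
      ((norm_rep_le _ _).trans ((hM' t ht).trans (le_max_right _ _)))
  intro t ht
  have h := norm_le_exp_of_norm_deriv_le (K := 2 * L)
    (fun t ht => hasDerivWithinAt_norm_toL2_sub_sq hu hw ht) (fun t ht => ?_) ht
  · rw [h0, sub_self, map_zero, norm_zero] at h
    have h1 : ‖toL2 (u t - w t)‖ ^ 2 ≤ 0 := (Real.le_norm_self _).trans (by simpa using h)
    have h2 : toL2 (u t - w t) = 0 := norm_eq_zero.1 (by nlinarith [norm_nonneg (toL2 (u t - w t))])
    exact sub_eq_zero.1 (toL2_injective (h2.trans (map_zero _).symm))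
  · rw [norm_mul, norm_neg, Real.norm_ofNat, norm_pow, norm_norm, Real.norm_eq_abs]
    have h1 := (Complex.abs_im_le_norm _).trans (norm_inner_le_norm (𝕜 := ℂ) (toL2 (u t - w t))
      (toL2 (nonlinH1 l₁ l₂ (u t) - nonlinH1 l₁ l₂ (w t))))
    have h2 := mul_le_mul_of_nonneg_left (hn t ht) (norm_nonneg (toL2 (u t - w t)))
    nlinarith

theorem eq_of_hasDerivWithinAt_zero {f : ℝ → ℝ}
    (hf : ∀ t ∈ Icc (-T) T, HasDerivWithinAt f 0 (Icc (-T) T) t) {t : ℝ} (ht : t ∈ Icc (-T) T) :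
    f t = f 0 := by
  have h := norm_le_exp_of_norm_deriv_le (K := 0) (fun t ht => (hf t ht).sub_const (f 0))
    (fun _ _ => by simp) ht
  simp only [sub_self, norm_zero, zero_mul, norm_le_zero_iff] at h
  exact sub_eq_zero.1 h

theorem isSolution_zero (J : Set ℝ) : IsSolution Z l₁ l₂ J fun _ => 0 := by
  have h0 : velocity Z l₁ l₂ 0 = 0 := by
    rw [velocity, (isSmoothNonlinearity_forcing Z l₁ l₂).map_zero]; simp
  refine isSolution_iff.2 ⟨continuousOn_const, fun t _ => ?_⟩
  rw [h0]
  exact hasDerivWithinAt_const _ _ _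

theorem IsSolution.hasDerivWithinAt_mass {J : Set ℝ} {u : ℝ → H1} (hu : IsSolution Z l₁ l₂ J u)
    {t : ℝ} (ht : t ∈ J) : HasDerivWithinAt (fun s => ‖toL2 (u s)‖ ^ 2) 0 J t := by
  have h := hasDerivWithinAt_norm_toL2_sub_sq hu (isSolution_zero J) ht
  simpa only [sub_zero, (isSmoothNonlinearity_nonlinH1 l₁ l₂).map_zero, im_inner_nonlinH1,
    mul_zero] using h

/-! ### Conservation of energy -/

/-- The energy `½ ⟨A_Z u, u⟩ - ∫ (λ₁/4 |u|⁴ + λ₂/6 |u|⁶)`. -/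
def energy (Z l₁ l₂ : ℝ) (u : H1) : ℝ :=
  1 / 2 * (‖derivL2 u‖ ^ 2 - Z * ‖rep u 0‖ ^ 2) - potential l₁ l₂ u

theorem energy_eq (u : H1) : energy Z l₁ l₂ u
    = 1 / 2 * (inner ℂ u (gramForm Z u)).re - shift Z / 2 * ‖toL2 u‖ ^ 2 - potential l₁ l₂ u := by
  rw [energy, re_inner_gramForm_self]
  ring

theorem continuous_energy : Continuous (energy Z l₁ l₂) := by
  have h0 : Continuous fun u : H1 => rep u 0 := (eval 0).continuous
  have h1 : Continuous modSq :=
    (mul.continuous).clm_apply conjL.continuous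
  have h2 : Continuous fun u : H1 => mul (modSq u) u :=
    (mul.continuous.comp h1).clm_apply continuous_id
  have h3 := toL2.continuous.comp h1
  have h4 := toL2.continuous.comp h2
  have h5 := derivL2.continuous
  unfold energy potential
  simp only [Function.comp_def] at h3 h4
  fun_prop

section Mild

variable {U : ℝ → H1 →L[ℂ] H1} {u₀ : H1} {u : ℝ → H1}

/-- The quadratic form of `A_Z + m` along a mild solution. It is invariant under the group, so
only the forcing contributes, and no regularity beyond `H¹(ℝ)` is required. -/
theorem IsMild.hasDerivWithinAt_form (hU : IsFormGroup Z U)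
    (hu : IsMild (fun t => (U t).restrictScalars ℝ) (forcing Z l₁ l₂) T u₀ u) {t : ℝ}
    (ht : t ∈ Icc (-T) T) :
    HasDerivWithinAt (fun s => (inner ℂ (u s) (gramForm Z (u s))).re)
      (2 * (inner ℂ (nonlinH1 l₁ l₂ (u t)) (gramForm Z (u t))).im) (Icc (-T) T) t := by
  have hB := hU.isBoundedGroup
  set v : ℝ → H1 := fun t => u₀ + ∫ s in (0 : ℝ)..t, (U (-s)) (forcing Z l₁ l₂ (u s)) with hv
  have hvd : HasDerivAt v (U (-t) (forcing Z l₁ l₂ (u t))) t :=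
    hasDerivAt_interaction hB (isSmoothNonlinearity_forcing Z l₁ l₂).continuous hu.1 u₀ t
  have huv : ∀ s ∈ Icc (-T) T, u s = U s (v s) := fun s hs => hu.2 s hs
  have h1 := Complex.reCLM.hasFDerivAt.comp_hasDerivAt t
    (hvd.inner ℂ (((gramForm Z).restrictScalars ℝ).hasFDerivAt.comp_hasDerivAt t hvd))
  have h2 : HasDerivAt (fun s => (inner ℂ (v s) (gramForm Z (v s))).re)
      (2 * (inner ℂ (nonlinH1 l₁ l₂ (u t)) (gramForm Z (u t))).im) t := by
    refine HasDerivAt.congr_deriv h1 ?_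
    refine Eq.trans (b := (inner ℂ (v t) (gramForm Z (U (-t) (forcing Z l₁ l₂ (u t))))).re
      + (inner ℂ (U (-t) (forcing Z l₁ l₂ (u t))) (gramForm Z (v t))).re) rfl ?_
    have e1 : (inner ℂ (v t) (gramForm Z (U (-t) (forcing Z l₁ l₂ (u t))))).re
        = (inner ℂ (U (-t) (forcing Z l₁ l₂ (u t))) (gramForm Z (v t))).re := by
      rw [← inner_conj_symm, Complex.conj_re]
      exact congrArg Complex.re ((isSelfAdjoint_gramForm Z).isSymmetric _ _)
    have e2 : U t (U (-t) (forcing Z l₁ l₂ (u t))) = forcing Z l₁ l₂ (u t) := hB.apply_neg t _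
    have e3 := hU.inner_gramForm t (U (-t) (forcing Z l₁ l₂ (u t))) (v t)
    rw [e2, ← huv t ht] at e3
    have e4 := im_inner_gramForm_self (Z := Z) (u t)
    rw [e1, ← e3, forcing, inner_smul_left, inner_add_left, ← Complex.coe_smul (shift Z) (u t),
      inner_smul_left]
    simp only [Complex.mul_re, Complex.add_re, Complex.add_im, Complex.mul_im, Complex.conj_re,
      Complex.conj_im, Complex.I_re, Complex.I_im, Complex.ofReal_re, Complex.ofReal_im, e4]
    ring
  refine h2.hasDerivWithinAt.congr (fun s hs => ?_) ?_
  · rw [huv s hs, hU.inner_gramForm]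
  · rw [huv t ht, hU.inner_gramForm]

theorem re_velocity_nonlinH1 (w : H1) : (velocity Z l₁ l₂ w (nonlinH1 l₁ l₂ w)).re
    = (inner ℂ (nonlinH1 l₁ l₂ w) (gramForm Z w)).im := by
  have h1 : (inner ℂ (toL2 (nonlinH1 l₁ l₂ w)) (toL2 w)).im = 0 := by
    rw [← inner_conj_symm, Complex.conj_im, im_inner_nonlinH1, neg_zero]
  have h2 : (inner ℂ (toL2 (nonlinH1 l₁ l₂ w)) (toL2 (nonlinH1 l₁ l₂ w))).im = 0 :=
    inner_self_im (𝕜 := ℂ) _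
  rw [velocity_apply]
  simp only [Complex.mul_re, Complex.mul_im, Complex.add_im, Complex.sub_im, Complex.I_re,
    Complex.I_im, h1, h2, Complex.ofReal_im, Complex.ofReal_re]
  ring

theorem IsMild.hasDerivWithinAt_energy (hU : IsFormGroup Z U)
    (hu : IsMild (fun t => (U t).restrictScalars ℝ) (forcing Z l₁ l₂) T u₀ u) {t : ℝ}
    (ht : t ∈ Icc (-T) T) :
    HasDerivWithinAt (fun s => energy Z l₁ l₂ (u s)) 0 (Icc (-T) T) t := by
  have h1 := hu.hasDerivWithinAt_form hU ht
  have h2 := (hu.isSolution_Icc hU).hasDerivWithinAt_mass ht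
  have h3 : HasDerivWithinAt (fun s => potential l₁ l₂ (u s)) _ (Icc (-T) T) t :=
    hasDerivWithinAt_of_gradient (isSmoothNonlinearity_nonlinH1 l₁ l₂).continuous
      hasDerivAt_potential hu.1.continuousWithinAt (hu.hasDerivWithinAt hU ht)
  have h := ((h1.const_mul (1 / 2)).sub (h2.const_mul (shift Z / 2))).sub h3
  refine (h.congr (fun s _ => energy_eq _) (energy_eq _)).congr_deriv ?_
  rw [re_velocity_nonlinH1]
  ring

end Mild

/-! ### The a priori bound -/

theorem norm_toL2_modSq_sq_le (u : H1) :
    ‖toL2 (modSq u)‖ ^ 2 ≤ 2 * ‖toL2 u‖ ^ 3 * ‖derivL2 u‖ := by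
  have h : ‖toL2 (modSq u)‖ ≤ Real.sqrt (2 * ‖toL2 u‖ * ‖derivL2 u‖) * ‖toL2 u‖ :=
    norm_toL2_le_mul fun x => by
      rw [rep_modSq, norm_pow, Complex.norm_real, norm_norm, sq]
      exact mul_le_mul_of_nonneg_right (Real.le_sqrt_of_sq_le (norm_rep_sq_le u x)) (norm_nonneg _)
  calc ‖toL2 (modSq u)‖ ^ 2 ≤ (Real.sqrt (2 * ‖toL2 u‖ * ‖derivL2 u‖) * ‖toL2 u‖) ^ 2 := by gcongr
    _ = 2 * ‖toL2 u‖ ^ 3 * ‖derivL2 u‖ := by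
      rw [mul_pow, Real.sq_sqrt (by positivity)]; ring

theorem norm_toL2_modSq_mul_sq_le (u : H1) :
    ‖toL2 (mul (modSq u) u)‖ ^ 2 ≤ 4 * ‖toL2 u‖ ^ 4 * ‖derivL2 u‖ ^ 2 := by
  have h : ‖toL2 (mul (modSq u) u)‖ ≤ 2 * ‖toL2 u‖ * ‖derivL2 u‖ * ‖toL2 u‖ :=
    norm_toL2_le_mul fun x => by
      rw [rep_mul, rep_modSq, norm_mul, norm_pow, Complex.norm_real, norm_norm]
      exact mul_le_mul_of_nonneg_right (norm_rep_sq_le u x) (norm_nonneg _)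
  calc ‖toL2 (mul (modSq u) u)‖ ^ 2 ≤ (2 * ‖toL2 u‖ * ‖derivL2 u‖ * ‖toL2 u‖) ^ 2 := by gcongr
    _ = _ := by ring

/-- Coercivity of the energy at fixed mass. The quintic term is the only one that scales like
`‖u'‖²`; it has a good sign or is absorbed by the smallness of the mass. -/
theorem norm_derivL2_sq_le {u : H1} (hu : l₂ * ‖toL2 u‖ ^ 4 ≤ 3 / 8) :
    ‖derivL2 u‖ ^ 2 ≤ 8 * energy Z l₁ l₂ u
      + 16 * (|Z| * ‖toL2 u‖ + |l₁| * ‖toL2 u‖ ^ 3 / 2) ^ 2 := by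
  have h1 : Z * ‖rep u 0‖ ^ 2 ≤ |Z| * (2 * ‖toL2 u‖ * ‖derivL2 u‖) :=
    mul_le_mul (le_abs_self Z) (norm_rep_sq_le u 0) (by positivity) (abs_nonneg Z)
  have h2 : l₁ * ‖toL2 (modSq u)‖ ^ 2 ≤ |l₁| * (2 * ‖toL2 u‖ ^ 3 * ‖derivL2 u‖) :=
    mul_le_mul (le_abs_self l₁) (norm_toL2_modSq_sq_le u) (by positivity) (abs_nonneg l₁)
  have h3 : l₂ * ‖toL2 (mul (modSq u) u)‖ ^ 2 ≤ 3 / 2 * ‖derivL2 u‖ ^ 2 := by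
    rcases le_total l₂ 0 with hl | hl
    · exact (mul_nonpos_of_nonpos_of_nonneg hl (by positivity)).trans (by positivity)
    · calc l₂ * ‖toL2 (mul (modSq u) u)‖ ^ 2 ≤ l₂ * (4 * ‖toL2 u‖ ^ 4 * ‖derivL2 u‖ ^ 2) :=
            mul_le_mul_of_nonneg_left (norm_toL2_modSq_mul_sq_le u) hl
        _ = 4 * (l₂ * ‖toL2 u‖ ^ 4) * ‖derivL2 u‖ ^ 2 := by ring
        _ ≤ 4 * (3 / 8) * ‖derivL2 u‖ ^ 2 := by gcongr
        _ = _ := by ring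
  rw [energy, potential]
  nlinarith [sq_nonneg (‖derivL2 u‖ - 4 * (|Z| * ‖toL2 u‖ + |l₁| * ‖toL2 u‖ ^ 3 / 2))]

/-- Solutions with data on the segment from `0` to `u₀` are bounded in `H¹(ℝ)` uniformly in time,
by conservation of mass and energy. -/
theorem exists_bound_of_isMild {U : ℝ → H1 →L[ℂ] H1} (hU : IsFormGroup Z U) {u₀ : H1}
    (hu₀ : l₂ * ‖toL2 u₀‖ ^ 4 ≤ 3 / 8) : ∃ M, ∀ T > 0, ∀ s ∈ Icc (0 : ℝ) 1, ∀ u : ℝ → H1,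
      IsMild (fun t => (U t).restrictScalars ℝ) (forcing Z l₁ l₂) T (s • u₀) u →
        ∀ t ∈ Icc (-T) T, ‖u t‖ ≤ M := by
  obtain ⟨E, hE⟩ := (isCompact_Icc (a := (0 : ℝ)) (b := 1)).exists_bound_of_continuousOn
    (f := fun s => energy Z l₁ l₂ (s • u₀))
    (continuous_energy.comp (continuous_id.smul continuous_const)).continuousOn
  set a := ‖toL2 u₀‖ with ha
  refine ⟨1 + (a ^ 2 + (8 * E + 16 * (|Z| * a + |l₁| * a ^ 3 / 2) ^ 2)),
    fun T hT s hs u hu t ht => ?_⟩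
  have h0 : u 0 = s • u₀ := hu.eq_zero hU.isBoundedGroup hT.le
  have hm : ‖toL2 (u t)‖ ^ 2 = ‖toL2 (u 0)‖ ^ 2 := eq_of_hasDerivWithinAt_zero
    (fun t ht => (hu.isSolution_Icc hU).hasDerivWithinAt_mass ht) ht
  have he : energy Z l₁ l₂ (u t) = energy Z l₁ l₂ (u 0) :=
    eq_of_hasDerivWithinAt_zero (fun t ht => hu.hasDerivWithinAt_energy hU ht) ht
  have hms : ‖toL2 (u t)‖ = s * a := by
    have := (pow_left_inj₀ (norm_nonneg _) (norm_nonneg _) two_ne_zero).1 hm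
    rw [this, h0, ← Complex.coe_smul, map_smul, norm_smul, Complex.norm_real,
      Real.norm_of_nonneg hs.1]
  have ha0 : 0 ≤ a := norm_nonneg _
  have hma : ‖toL2 (u t)‖ ≤ a := hms ▸ mul_le_of_le_one_left ha0 hs.2
  have hsmall : l₂ * ‖toL2 (u t)‖ ^ 4 ≤ 3 / 8 := by
    rcases le_total l₂ 0 with hl | hl
    · exact (mul_nonpos_of_nonpos_of_nonneg hl (by positivity)).trans (by norm_num)
    · exact (mul_le_mul_of_nonneg_left (pow_le_pow_left₀ (norm_nonneg _) hma 4) hl).trans hu₀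
  have hd := norm_derivL2_sq_le (Z := Z) (l₁ := l₁) hsmall
  have hEs : energy Z l₁ l₂ (u t) ≤ E := by
    rw [he, h0]
    exact (Real.le_norm_self _).trans (hE s hs)
  have hd' : ‖derivL2 (u t)‖ ^ 2 ≤ 8 * E + 16 * (|Z| * a + |l₁| * a ^ 3 / 2) ^ 2 :=
    hd.trans (by gcongr)
  have hma2 : ‖toL2 (u t)‖ ^ 2 ≤ a ^ 2 := by gcongr
  have := norm_sq_eq (u t)
  nlinarith [sq_nonneg (‖u t‖ - 1)]

/-! ### Global well-posedness -/

/-- Both parts of the result at once: the smallness condition is void for `λ₂ ≤ 0`. -/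
theorem globallyWellPosed_of_isOpen (Z l₁ : ℝ) {D : Set H1} (hD : IsOpen D)
    (hsmall : ∀ u₀ ∈ D, l₂ * ‖toL2 u₀‖ ^ 4 ≤ 3 / 8) : GloballyWellPosed Z l₁ l₂ D := by
  obtain ⟨U, hU⟩ := exists_isFormGroup Z
  obtain ⟨S, hS, hsm⟩ := exists_smooth_flow hU.isBoundedGroup
    (isSmoothNonlinearity_forcing Z l₁ l₂) hD fun u₀ hu₀ T hT => by
      obtain ⟨M, hM⟩ := exists_bound_of_isMild (l₁ := l₁) hU (hsmall u₀ hu₀)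
      exact ⟨M, hM T hT⟩
  have h0 : ∀ u₀ ∈ D, S u₀ 0 = u₀ := fun u₀ hu₀ =>
    (hS u₀ hu₀ 1 one_pos).eq_zero hU.isBoundedGroup zero_le_one
  refine ⟨S, fun u₀ hu₀ => ⟨isSolution_univ_of_isMild hU (hS u₀ hu₀), h0 u₀ hu₀,
    fun T hT w hw hw0 => ?_⟩, hsm⟩
  exact hw.eqOn ((hS u₀ hu₀ T hT).isSolution_Icc hU) (hw0.trans (h0 u₀ hu₀).symm)

end DeltaNLS

end

theorem theorem2p2 :
    (∀ lam₂ : ℝ, 0 < lam₂ → ∃ δ : ℝ, 0 < δ ∧ ∀ Z lam₁ : ℝ,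
      DeltaNLS.GloballyWellPosed Z lam₁ lam₂ {u₀ : DeltaNLS.H1 | ‖DeltaNLS.H1.toL2 u₀‖ < δ}) ∧
    (∀ lam₂ : ℝ, lam₂ < 0 → ∀ Z lam₁ : ℝ,
      DeltaNLS.GloballyWellPosed Z lam₁ lam₂ Set.univ) := by
  constructor
  · intro lam₂ h
    -- then `lam₂ ‖u₀‖⁴ ≤ lam₂ ‖u₀‖ ≤ 3/8`
    refine ⟨min 1 (3 / (8 * lam₂)), by positivity, fun Z lam₁ => ?_⟩
    refine DeltaNLS.globallyWellPosed_of_isOpen Z lam₁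
      (isOpen_lt DeltaNLS.H1.toL2.continuous.norm continuous_const) fun u₀ hu₀ => ?_
    have h1 : ‖DeltaNLS.H1.toL2 u₀‖ ≤ 1 := (lt_min_iff.1 hu₀).1.le
    have h2 : ‖DeltaNLS.H1.toL2 u₀‖ < 3 / (8 * lam₂) := (lt_min_iff.1 hu₀).2
    have h3 : ‖DeltaNLS.H1.toL2 u₀‖ ^ 4 ≤ ‖DeltaNLS.H1.toL2 u₀‖ :=
      pow_le_of_le_one (norm_nonneg _) h1 four_ne_zero
    rw [lt_div_iff₀ (by positivity)] at h2
    nlinarith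
  · intro lam₂ h Z lam₁
    refine DeltaNLS.globallyWellPosed_of_isOpen Z lam₁ isOpen_univ fun u₀ _ => ?_
    exact (mul_nonpos_of_nonpos_of_nonneg h.le (by positivity)).trans (by norm_num)
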